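/- \textbf{Theorem.} Let $\kappa>0$ and let $Z=(Z_t)_{t\ge 0}$ be a real-valued c\`adl\`ag $\kappa$-self-similar Markov martingale, i.e. $(Z_{ct})_{t\ge0}\stackrel{d}{=}(c^{\kappa}Z_t)_{t\ge0}$ for all $c>0$ (so $Z_0=0$), with transition function $P(s,t,x,dy)$, $0\le s\le t$, where $x\in\mathbb R$ if $s>0$ and $x=0$ if $s=0$. At all these $(s,t,x)$, $P$ is assumed to satisfy the Chapman--Kolmogorov equations with $P(s,s,x,\cdot)=\delta_x$, the scaling property $P(cs,ct,c^\kappa x,c^\kappa dy)=P(s,t,x,dy)$ for $c>0$, and the martingale property $\int |y|\,P(s,t,x,dy)<\infty$, $\int y\,P(s,t,x,dy)=x$; moreover $t\mapsto P(s,t,x,\cdot)$ is weakly right-continuous on $[s,\infty)$. Let $\zeta$ be a subordinator with drift $\beta\ge 0$ and L\'evy measure $\nu$ on $(0,\infty)$, $\int(1\wedge x)\,\nu(dx)<\infty$, so that $\mathbb E[e^{-\lambda\zeta_a}]=e^{-a\psi(\lambda)}$ with $\psi(\lambda)=\beta\lambda+\int_{(0,\infty)}(1-e^{-\lambda x})\,\nu(dx)$,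 and suppose that $\psi(\kappa)=\kappa$. Let the mimic $X$ be a Markov process with $X_0=0$ and transition function $\widetilde P(0,t,0,dy)=P(0,t,0,dy)$ and, for $0<s\le t$, $$\widetilde P(s,t,x,dy)=\mathbb E\big[P\big(Rt,\,t,\,(t/s)^\kappa R^\kappa x,\,dy\big)\big],\qquad R=e^{-\zeta_{\ln(t/s)}} .$$ The infinitesimal generator of a Markov process with transition function $Q$ is $$ Q_t f(x)=\lim_{u\downarrow t}\frac{\int f(y)\,Q(t,u,x,dy)-f(x)}{u-t};$$ its domain at time $t$ is the set of measurable $f$, integrable with respect to $Q(t,u,x,\cdot)$ for all $u\ge t$, for which this limit exists, for every state $x$ at time $t$ (every $x\in\mathbb R$ if $t>0$, and $x=0$ if $t=0$). Let $L_t$ and $A_t$ be the generators of $Z$ and $X$ in this sense. (i) If $f$ is in the domain of $L_0$, then $f$ is in the domain of $A_0$ and $A_0f(x)=L_0f(x)$ (at $x=0$, the only state at time $0$). (ii) Let $p\ge 0$ be such that $\sup_{u\ge 0}\int |y|^p\,P(te^{-u},t,xe^{-u\kappa},dy)<\infty$ for all $t>0$ and $x\in\mathbb R$ (no restriction if $p=0$).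 Let $t>0$ and let $f$ be a continuously differentiable function in the domain of $L_t$ such that, for some constant $C$, $|f(y)|\le C(1+|y|^p)$ and $|f'(y)|\le C(1+|y|^{\max(p-1,0)})$ for all $y$ (if $p=0$: $f$ and $f'$ are bounded). Then $f$ is in the domain of $A_t$ and, for every $x\in\mathbb R$, $$A_tf(x)=\beta L_tf(x)+(1-\beta)\frac{\kappa}{t}\,x f'(x)+\frac1t\int_{(0,\infty)}\int_{-\infty}^{\infty}\big(f(y)-f(x)\big)\,P\big(te^{-u},t,xe^{-u\kappa},dy\big)\,\nu(du),$$ where the inner integral converges absolutely for every $u>0$ and is a $\nu$-integrable function of $u$. -/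

import Mathlib

open MeasureTheory ProbabilityTheory Filter Topology Set
open scoped NNReal ENNReal

namespace Mimic

/-- The states that a self-similar process can occupy at time `t`: it sits at `0` at time `0`,
and any real number is allowed at a positive time. -/
def states (t : ℝ≥0) : Set ℝ := {x | t = 0 → x = 0}

/-- A family `P s t x`, `s ≤ t`, of measures on `ℝ` is a (Markov) transition function. Only the
values at times `s ≤ t` are meaningful, and only starting points in `states s` matter. -/
structure IsTransitionFunction (P : ℝ≥0 → ℝ≥0 → ℝ → Measure ℝ) : Prop where
  isProbability : ∀ s t x, s ≤ t → IsProbabilityMeasure (P s t x)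
  measurable : ∀ s t, s ≤ t → Measurable (P s t)
  refl : ∀ s, ∀ x ∈ states s, P s s x = Measure.dirac x
  chapmanKolmogorov : ∀ s t u, s ≤ t → t ≤ u → ∀ x ∈ states s,
    (P s t x).bind (P t u) = P s u x

/-- The scaling property `P(cs, ct, c^κ x, c^κ dy) = P(s, t, x, dy)`. -/
def IsScaling (P : ℝ≥0 → ℝ≥0 → ℝ → Measure ℝ) (κ : ℝ) : Prop :=
  ∀ c : ℝ≥0, 0 < c → ∀ s t, s ≤ t → ∀ x ∈ states s,
    P (c * s) (c * t) ((c : ℝ) ^ κ * x) = (P s t x).map (fun y => (c : ℝ) ^ κ * y)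

/-- The martingale property of a transition function: `∫ y P(s, t, x, dy) = x`. -/
def IsMartingaleTransition (P : ℝ≥0 → ℝ≥0 → ℝ → Measure ℝ) : Prop :=
  ∀ s t, s ≤ t → ∀ x ∈ states s, Integrable (fun y => y) (P s t x) ∧ ∫ y, y ∂(P s t x) = x

/-- The law at time `t` of the process started from `x` at time `s` is right-continuous in `t`
(for weak convergence), as it is for a process with right-continuous paths. -/
def IsRightContinuousTransition (P : ℝ≥0 → ℝ≥0 → ℝ → Measure ℝ) : Prop :=
  ∀ s t, s ≤ t → ∀ x ∈ states s, ∀ g : BoundedContinuousFunction ℝ ℝ,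
    Tendsto (fun u => ∫ y, g y ∂(P s u x)) (𝓝[>] t) (𝓝 (∫ y, g y ∂(P s t x)))

/-- All paths are right-continuous with left limits. -/
def IsCadlag {Ω : Type*} (Z : ℝ≥0 → Ω → ℝ) : Prop :=
  ∀ ω t, ContinuousWithinAt (fun s => Z s ω) (Ici t) t ∧
    ∃ l, Tendsto (fun s => Z s ω) (𝓝[<] t) (𝓝 l)

/-- `Z` is a Markov process, for its natural filtration, with transition function `P`:
the conditional law of `Z t` given the past up to time `s` is `P s t (Z s)`. -/
structure IsMarkovProcess {Ω : Type*} [MeasurableSpace Ω] (Z : ℝ≥0 → Ω → ℝ)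
    (P : ℝ≥0 → ℝ≥0 → ℝ → Measure ℝ) (μ : Measure Ω) : Prop where
  measurable : ∀ t, Measurable (Z t)
  markov : ∀ s t, s ≤ t → ∀ B, MeasurableSet B →
    μ[(Z t ⁻¹' B).indicator (fun _ => (1 : ℝ)) |
        Filtration.natural Z (fun t => (measurable t).stronglyMeasurable) s]
      =ᵐ[μ] fun ω => (P s t (Z s ω)).real B

/-- `(Z_{ct})_{t ≥ 0}` and `(c^κ Z_t)_{t ≥ 0}` have the same finite-dimensional distributions
for all `c > 0` (equality of laws for the product σ-algebra). -/
def IsSelfSimilar {Ω : Type*} [MeasurableSpace Ω] (Z : ℝ≥0 → Ω → ℝ) (κ : ℝ)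
    (μ : Measure Ω) : Prop :=
  ∀ c : ℝ≥0, 0 < c →
    μ.map (fun ω t => Z (c * t) ω) = μ.map (fun ω t => (c : ℝ) ^ κ * Z t ω)

/-- `Z` is a càdlàg `κ`-self-similar Markov martingale with transition function `P`. -/
structure IsSelfSimilarMarkovMartingale {Ω : Type*} [MeasurableSpace Ω] (Z : ℝ≥0 → Ω → ℝ)
    (P : ℝ≥0 → ℝ≥0 → ℝ → Measure ℝ) (κ : ℝ) (μ : Measure Ω) : Prop where
  isMarkov : IsMarkovProcess Z P μ
  isMartingale : Martingale Z
    (Filtration.natural Z (fun t => (isMarkov.measurable t).stronglyMeasurable)) μ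
  isSelfSimilar : IsSelfSimilar Z κ μ
  isCadlag : IsCadlag Z
  transition : IsTransitionFunction P
  scaling : IsScaling P κ
  martingaleTransition : IsMartingaleTransition P
  rightContinuous : IsRightContinuousTransition P

/-- `ν` is the Lévy measure of a subordinator: a measure on `(0, ∞)` with
`∫ (1 ∧ x) ν(dx) < ∞`. -/
def IsSubordinatorLevyMeasure (ν : Measure ℝ) : Prop :=
  ν (Iic 0) = 0 ∧ ∫⁻ x, ENNReal.ofReal (min 1 x) ∂ν < ∞

/-- The Laplace exponent `ψ(λ) = β λ + ∫_{(0,∞)} (1 - e^{-λ x}) ν(dx)`. -/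
noncomputable def laplaceExponent (β : ℝ) (ν : Measure ℝ) (l : ℝ) : ℝ :=
  β * l + ∫ x in Ioi 0, (1 - Real.exp (-(l * x))) ∂ν

/-- `ζ` is a subordinator with drift `β` and Lévy measure `ν`. -/
structure IsSubordinator {Ω : Type*} [MeasurableSpace Ω] (ζ : ℝ≥0 → Ω → ℝ)
    (β : ℝ) (ν : Measure ℝ) (μ : Measure Ω) : Prop where
  measurable : ∀ a, Measurable (ζ a)
  zero : ∀ ω, ζ 0 ω = 0
  monotone : ∀ ω, Monotone (fun a => ζ a ω)
  isCadlag : IsCadlag ζ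
  indepIncrements : HasIndepIncrements ζ μ
  stationaryIncrements : ∀ a b, μ.map (fun ω => ζ (a + b) ω - ζ a ω) = μ.map (ζ b)
  drift_nonneg : 0 ≤ β
  levyMeasure : IsSubordinatorLevyMeasure ν
  laplace : ∀ (a : ℝ≥0) (l : ℝ), 0 ≤ l →
    ∫ ω, Real.exp (-(l * ζ a ω)) ∂μ = Real.exp (-(a * laplaceExponent β ν l))

/-- The random factor `R = exp (-ζ_{ln r})`, for a ratio of times `r = t / s ≥ 1`. -/
noncomputable def randomFactor {Ω : Type*} (ζ : ℝ≥0 → Ω → ℝ) (r : ℝ≥0) (ω : Ω) : ℝ≥0 :=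
  Real.toNNReal (Real.exp (-(ζ (Real.toNNReal (Real.log (r : ℝ))) ω)))

/-- The transition function of the mimic, obtained by randomising the one of `Z`: for `0 < s ≤ t`,
it is the mixture `E [P(R t, t, (t/s)^κ R^κ x, dy)]` with `R = exp (-ζ_{ln (t/s)})`, and from
time `0` it is the one of `Z`. -/
noncomputable def mimicTransition {Ω : Type*} [MeasurableSpace Ω]
    (P : ℝ≥0 → ℝ≥0 → ℝ → Measure ℝ) (κ : ℝ) (ζ : ℝ≥0 → Ω → ℝ) (μ : Measure Ω) :
    ℝ≥0 → ℝ≥0 → ℝ → Measure ℝ :=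
  fun s t x =>
    if s = 0 then P 0 t x
    else (μ.map (randomFactor ζ (t / s))).bind
      (fun r : ℝ≥0 => P (r * t) t (((t / s : ℝ≥0) : ℝ) ^ κ * (r : ℝ) ^ κ * x))

/-- `X` is the mimic of the process with transition function `P` that is associated with the
subordinator `ζ`: a Markov process started from `0` whose transition function is the
randomised one. -/
structure IsMimic {Ω Ω' : Type*} [MeasurableSpace Ω] [MeasurableSpace Ω']
    (X : ℝ≥0 → Ω' → ℝ) (μ' : Measure Ω') (P : ℝ≥0 → ℝ≥0 → ℝ → Measure ℝ) (κ : ℝ)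
    (ζ : ℝ≥0 → Ω → ℝ) (μ : Measure Ω) : Prop where
  isMarkov : IsMarkovProcess X (mimicTransition P κ ζ μ) μ'
  zero : ∀ᵐ ω ∂μ', X 0 ω = 0

/-- `a = lim_{u ↓ t} (∫ f(y) P(t, u, x, dy) - f(x)) / (u - t)`. -/
def HasGeneratorAt (P : ℝ≥0 → ℝ≥0 → ℝ → Measure ℝ) (t : ℝ≥0) (f : ℝ → ℝ) (x a : ℝ) : Prop :=
  Tendsto (fun u : ℝ≥0 => (∫ y, f y ∂(P t u x) - f x) / ((u : ℝ) - t)) (𝓝[>] t) (𝓝 a)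

/-- `L t`, with domain `D t`, is the infinitesimal generator at time `t` of a Markov process with
transition function `P`. The domain consists of the measurable functions that are integrable for
the transition probabilities and for which the limit above exists at each state `x`; the generator
is this limit. -/
structure IsGenerator (P : ℝ≥0 → ℝ≥0 → ℝ → Measure ℝ) (D : ℝ≥0 → Set (ℝ → ℝ))
    (L : ℝ≥0 → (ℝ → ℝ) → ℝ → ℝ) : Prop where
  mem_iff : ∀ t f, f ∈ D t ↔ Measurable f ∧ ∀ x ∈ states t,
    (∀ u, t ≤ u → Integrable f (P t u x)) ∧ ∃ a, HasGeneratorAt P t f x a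
  hasGeneratorAt : ∀ t, ∀ f ∈ D t, ∀ x ∈ states t, HasGeneratorAt P t f x (L t f x)

/-- `e^{-u}` as a nonnegative real. -/
noncomputable def expNeg (u : ℝ) : ℝ≥0 := Real.toNNReal (Real.exp (-u))

/-- For `t > 0` and each `x`, the `p`-th absolute moments of the probability measures
`P(t e^{-u}, t, x e^{-uκ}, dy)` are bounded uniformly in `u ≥ 0`. No restriction for `p = 0`. -/
def HasBoundedMoments (P : ℝ≥0 → ℝ≥0 → ℝ → Measure ℝ) (κ p : ℝ) : Prop :=
  ∀ t : ℝ≥0, 0 < t → ∀ x : ℝ, ∃ M : ℝ≥0, ∀ u : ℝ, 0 ≤ u →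
    ∫⁻ y, ENNReal.ofReal (|y| ^ p) ∂(P (t * expNeg u) t (x * Real.exp (-(u * κ)))) ≤ M

/-- `f` is continuously differentiable, `|f(y)| ≤ C (1 + |y|^p)` and
`|f'(y)| ≤ C (1 + |y|^{max(p-1,0)})`. For `p = 0`: `f` is `C¹`, and `f`, `f'` are bounded. -/
def IsC1OfGrowth (p : ℝ) (f : ℝ → ℝ) : Prop :=
  ContDiff ℝ 1 f ∧ ∃ C : ℝ, ∀ y, |f y| ≤ C * (1 + |y| ^ p) ∧
    |deriv f y| ≤ C * (1 + |y| ^ (max (p - 1) 0))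

end Mimic

/-! Let `m a` be the law of `ζ a`, and write `u = t e^a`. By scaling, the law of the mimic at time
`u`, started from `x` at time `t`, is the image under the dilation by `e^{aκ}` of the mixture over
`z ~ m a` of `K z = P(t e^{-z}, t, x e^{-zκ}, ·)`. Scaling again makes `K z` the image of `Q z =
P(t, t e^z, x, ·)` under the dilation by `e^{-zκ}`.

Put `G(z) = ∫ f dK_z`, so that `G(0) = f(x)`. The increment of the mimic's semigroup splits into `∫
(G - G(0)) dm_a` and `∫∫ (f(e^{aκ} y) - f(y)) K_z(dy) m_a(dz)`. Divided by `a ↓ 0`, the second part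
tends to `κ x f'(x)`, because `m a` concentrates at `0`. The first part tends to the generator of
the subordinator applied to `G` at `0`, namely `β G'(0+) + ∫ (G - G(0)) dν`. Here `G'(0+) = t L_t
f(x) - κ x f'(x)`: one term comes from the motion of `Q z`, the other from the dilation. Since `a /
(u - t) → 1/t`, the formula follows (`tendsto_mixture`, `hasGeneratorAt_mimicTransition`).

There are two difficulties. First, `G` is only right-continuous and `ν` may charge its jumps, so
weak convergence of `(1 - e^{-z}) m_a(dz) / a`, which the Laplace transforms give, does not suffice.
Independence of increments supplies the missing one-sided bound `m_a[b,∞) ≥ 1 - exp(-a ν[b,∞))`,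
with the closed half-line on both sides. It yields asymptotic lower bounds for monotone integrands,
and right-continuous functions are approximated from below by monotone functions plus multiples of
`e^{-z}` (`tendsto_integral_of_monotone`, `tendsto_integral_sub_div`). Second, `f` may be unbounded.
The martingale property makes `Q z` increase for the convex order, which gives uniform integrability
on compact intervals of `z` (`isConvexFlow_transition`, `exists_integral_excess_le`). -/

namespace Mimic

/-! ### One-dimensional laws of a subordinator and the Laplace exponent -/

/-- The laws `m a` of a subordinator with drift `β` and Lévy measure `ν` at the times `a`. -/
structure IsSubordinatorLaw (m : ℝ≥0 → Measure ℝ) (β : ℝ) (ν : Measure ℝ) : Prop where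
  isProbability : ∀ a, IsProbabilityMeasure (m a)
  nonneg : ∀ a, ∀ᵐ z ∂m a, 0 ≤ z
  measure_Iio_add_le : ∀ a b c, m (a + b) (Iio c) ≤ m a (Iio c) * m b (Iio c)
  drift_nonneg : 0 ≤ β
  levyMeasure : IsSubordinatorLevyMeasure ν
  laplace : ∀ (a : ℝ≥0) (l : ℝ), 0 ≤ l →
    ∫ z, Real.exp (-(l * z)) ∂(m a) = Real.exp (-(a * laplaceExponent β ν l))

/-- Only one consequence of independent stationary increments is retained. If `ζ_{a+b} < c`, then by
positivity both `ζ_a` and the increment `ζ_{a+b} - ζ_a` are below `c`, and these two events are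
independent. -/
lemma IsSubordinator.isSubordinatorLaw {Ω : Type*} [MeasurableSpace Ω] {μ : Measure Ω}
    [IsProbabilityMeasure μ] {β : ℝ} {ν : Measure ℝ} {ζ : ℝ≥0 → Ω → ℝ}
    (h : IsSubordinator ζ β ν μ) : IsSubordinatorLaw (fun a => μ.map (ζ a)) β ν where
  isProbability a := Measure.isProbabilityMeasure_map (h.measurable a).aemeasurable
  nonneg a := by
    rw [ae_map_iff (h.measurable a).aemeasurable measurableSet_Ici]
    refine .of_forall fun ω => ?_
    have := h.monotone ω (zero_le (a := a))
    simpa [h.zero ω] using this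
  measure_Iio_add_le a b c := by
    have hind : IndepFun (ζ a) (ζ (a + b) - ζ a) μ :=
      h.indepIncrements.indepFun_eval_sub (zero_le (a := a)) (by simp) (.of_forall h.zero)
    have hmeas : Measurable (ζ (a + b) - ζ a) := (h.measurable _).sub (h.measurable _)
    have hmap : μ.map (ζ b) = μ.map (ζ (a + b) - ζ a) := (h.stationaryIncrements a b).symm
    rw [hmap, Measure.map_apply (h.measurable _) measurableSet_Iio,
      Measure.map_apply (h.measurable _) measurableSet_Iio,
      Measure.map_apply hmeas measurableSet_Iio,
      ← hind.measure_inter_preimage_eq_mul _ _ measurableSet_Iio measurableSet_Iio]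
    refine measure_mono fun ω (hω : ζ (a + b) ω < c) => ?_
    have h1 : ζ a ω ≤ ζ (a + b) ω := h.monotone ω (by simp)
    have h2 : 0 ≤ ζ a ω := by simpa [h.zero ω] using h.monotone ω (zero_le (a := a))
    constructor
    · exact h1.trans_lt hω
    · change ζ (a + b) ω - ζ a ω < c
      linarith
  drift_nonneg := h.drift_nonneg
  levyMeasure := h.levyMeasure
  laplace a l hl := by
    rw [integral_map (h.measurable a).aemeasurable (by fun_prop)]
    exact h.laplace a l hl

lemma one_sub_exp_le_mul_min {l x : ℝ} (hx : 0 ≤ x) :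
    1 - Real.exp (-(l * x)) ≤ max 1 l * min 1 x := by
  have h1 := Real.add_one_le_exp (-(l * x))
  have h2 := Real.exp_pos (-(l * x))
  rcases le_total 1 x with h | h
  · rw [min_eq_left h]; have := le_max_left 1 l; linarith
  · rw [min_eq_right h]
    have := mul_le_mul_of_nonneg_right (le_max_right 1 l) hx
    linarith

lemma one_sub_exp_nonneg {l x : ℝ} (hl : 0 ≤ l) (hx : 0 ≤ x) :
    0 ≤ 1 - Real.exp (-(l * x)) := by
  have : Real.exp (-(l * x)) ≤ 1 := Real.exp_le_one_iff.2 (by nlinarith [mul_nonneg hl hx])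
  linarith

lemma IsSubordinatorLevyMeasure.integrableOn_min {ν : Measure ℝ}
    (h : IsSubordinatorLevyMeasure ν) : IntegrableOn (fun x => min 1 x) (Ioi 0) ν := by
  refine ⟨by fun_prop, ?_⟩
  rw [hasFiniteIntegral_iff_ofReal]
  · exact (lintegral_mono' Measure.restrict_le_self le_rfl).trans_lt h.2
  · filter_upwards [ae_restrict_mem measurableSet_Ioi] with x hx
    exact le_min zero_le_one (le_of_lt hx)

lemma IsSubordinatorLevyMeasure.integrableOn_exp {ν : Measure ℝ}
    (h : IsSubordinatorLevyMeasure ν) {l : ℝ} (hl : 0 ≤ l) :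
    IntegrableOn (fun x => 1 - Real.exp (-(l * x))) (Ioi 0) ν := by
  refine (h.integrableOn_min.const_mul (max 1 l)).mono' (by fun_prop) ?_
  filter_upwards [ae_restrict_mem measurableSet_Ioi] with x hx
  rw [Real.norm_of_nonneg (one_sub_exp_nonneg hl (le_of_lt hx))]
  exact one_sub_exp_le_mul_min (le_of_lt hx)

lemma IsSubordinatorLevyMeasure.measure_Ici_lt_top {ν : Measure ℝ}
    (h : IsSubordinatorLevyMeasure ν) {b : ℝ} (hb : 0 < b) : ν (Ici b) < ∞ := by
  have hm : 0 < min 1 b := lt_min one_pos hb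
  have h1 := meas_ge_le_lintegral_div (μ := ν) (f := fun x => ENNReal.ofReal (min 1 x))
    (by fun_prop) (ε := ENNReal.ofReal (min 1 b)) (by simpa using hb) ENNReal.ofReal_ne_top
  refine (measure_mono ?_).trans_lt (h1.trans_lt (ENNReal.div_lt_top h.2.ne (by simpa using hb)))
  intro x hx
  exact ENNReal.ofReal_le_ofReal (min_le_min_left 1 hx)

lemma laplaceExponent_nonneg {β : ℝ} {ν : Measure ℝ} (hβ : 0 ≤ β) {l : ℝ} (hl : 0 ≤ l) :
    0 ≤ laplaceExponent β ν l :=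
  add_nonneg (mul_nonneg hβ hl)
    (setIntegral_nonneg measurableSet_Ioi fun _ hx => one_sub_exp_nonneg hl (le_of_lt hx))

/-- The Laplace exponent is right-continuous at `0`. -/
lemma tendsto_laplaceExponent_zero {β : ℝ} {ν : Measure ℝ} (hν : IsSubordinatorLevyMeasure ν) :
    Tendsto (laplaceExponent β ν) (𝓝[>] 0) (𝓝 0) := by
  have h1 : Tendsto (fun l : ℝ => ∫ x in Ioi 0, (1 - Real.exp (-(l * x))) ∂ν) (𝓝[>] 0)
      (𝓝 (∫ x in Ioi (0 : ℝ), (0 : ℝ) ∂ν)) := by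
    refine tendsto_integral_filter_of_dominated_convergence (fun x => min 1 x)
      (.of_forall fun l => by fun_prop) ?_ hν.integrableOn_min ?_
    · filter_upwards [Ioo_mem_nhdsGT (zero_lt_one' ℝ)] with l hl
      filter_upwards [ae_restrict_mem measurableSet_Ioi] with x hx
      rw [Real.norm_of_nonneg (one_sub_exp_nonneg hl.1.le (le_of_lt hx))]
      have := one_sub_exp_le_mul_min (l := l) (le_of_lt hx)
      rwa [max_eq_left hl.2.le, one_mul] at this
    · refine .of_forall fun x => ?_
      have : Tendsto (fun l : ℝ => 1 - Real.exp (-(l * x))) (𝓝 0)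
          (𝓝 (1 - Real.exp (-(0 * x)))) := Continuous.tendsto (by fun_prop) 0
      simpa using this.mono_left nhdsWithin_le_nhds
  have h2 : Tendsto (fun l : ℝ => β * l) (𝓝[>] 0) (𝓝 (β * 0)) :=
    ((continuous_const.mul continuous_id).tendsto 0).mono_left nhdsWithin_le_nhds
  have h3 : Tendsto (laplaceExponent β ν) (𝓝[>] 0) _ := h2.add h1
  simpa only [mul_zero, integral_zero, add_zero] using h3

lemma tendsto_one_sub_exp_div (c : ℝ) :
    Tendsto (fun a : ℝ≥0 => (1 - Real.exp (-(a * c))) / a) (𝓝[>] 0) (𝓝 c) := by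
  have hd : HasDerivAt (fun a : ℝ => - Real.exp (-(a * c))) c 0 := by
    have h1 : HasDerivAt (fun a : ℝ => -(a * c)) (-c) 0 := by
      simpa using ((hasDerivAt_id' (0 : ℝ)).mul_const c).fun_neg
    simpa using h1.exp.fun_neg
  have hc : Tendsto (fun a : ℝ≥0 => (a : ℝ)) (𝓝[>] 0) (𝓝[>] 0) := by
    refine tendsto_nhdsWithin_iff.2 ⟨?_, ?_⟩
    · exact (NNReal.continuous_coe.tendsto 0).mono_left nhdsWithin_le_nhds
    · filter_upwards [self_mem_nhdsWithin] with a ha using by simpa using ha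
  refine (hd.tendsto_slope_zero_right.comp hc).congr fun a => ?_
  simp only [smul_eq_mul, Function.comp_apply, zero_add, zero_mul, neg_zero, Real.exp_zero]
  ring

namespace IsSubordinatorLaw

variable {m : ℝ≥0 → Measure ℝ} {β : ℝ} {ν : Measure ℝ}

lemma integrable_exp (h : IsSubordinatorLaw m β ν) (a : ℝ≥0) {l : ℝ} (hl : 0 ≤ l) :
    Integrable (fun z => Real.exp (-(l * z))) (m a) := by
  have := h.isProbability a
  refine (integrable_const (1 : ℝ)).mono' (by fun_prop) ?_
  filter_upwards [h.nonneg a] with z hz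
  rw [Real.norm_of_nonneg (Real.exp_pos _).le]
  linarith [one_sub_exp_nonneg hl hz]

lemma integrable_one_sub_exp (h : IsSubordinatorLaw m β ν) (a : ℝ≥0) {l : ℝ} (hl : 0 ≤ l) :
    Integrable (fun z => 1 - Real.exp (-(l * z))) (m a) := by
  have := h.isProbability a
  exact (integrable_const _).sub (h.integrable_exp a hl)

lemma integral_one_sub_exp (h : IsSubordinatorLaw m β ν) (a : ℝ≥0) {l : ℝ} (hl : 0 ≤ l) :
    ∫ z, (1 - Real.exp (-(l * z))) ∂(m a) = 1 - Real.exp (-(a * laplaceExponent β ν l)) := by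
  have := h.isProbability a
  rw [integral_sub (integrable_const _) (h.integrable_exp a hl), h.laplace a l hl]
  simp

lemma integral_one_sub_exp_le (h : IsSubordinatorLaw m β ν) (a : ℝ≥0) {l : ℝ} (hl : 0 ≤ l) :
    ∫ z, (1 - Real.exp (-(l * z))) ∂(m a) ≤ a * laplaceExponent β ν l := by
  rw [h.integral_one_sub_exp a hl]
  linarith [Real.add_one_le_exp (-(a * laplaceExponent β ν l))]

lemma tendsto_integral_one_sub_exp (h : IsSubordinatorLaw m β ν) {l : ℝ} (hl : 0 ≤ l) :
    Tendsto (fun a : ℝ≥0 => (∫ z, (1 - Real.exp (-(l * z))) ∂(m a)) / a) (𝓝[>] 0)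
      (𝓝 (laplaceExponent β ν l)) := by
  simp_rw [h.integral_one_sub_exp _ hl]
  exact tendsto_one_sub_exp_div _

/-- Markov's inequality: on `z ≥ δ` the integrand `1 - e^{-z/δ}` is at least `1 - e^{-1}`. For fixed
`δ` the tail is `O(a)`, and for large `δ` the constant is small because the exponent tends to `0` at
`0`. -/
lemma measure_Ici_le (h : IsSubordinatorLaw m β ν) (a : ℝ≥0) {δ : ℝ} (hδ : 0 < δ) :
    (m a).real (Ici δ) * (1 - Real.exp (-1)) ≤ a * laplaceExponent β ν δ⁻¹ := by
  have := h.isProbability a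
  have hi : 0 ≤ δ⁻¹ := (inv_pos.2 hδ).le
  refine le_trans ?_ (h.integral_one_sub_exp_le a hi)
  have h1 : ∫ z in Ici δ, (1 - Real.exp (-1)) ∂(m a) = (m a).real (Ici δ) * (1 - Real.exp (-1)) := by
    simp
  rw [← h1, ← integral_indicator measurableSet_Ici]
  refine integral_mono_ae ((integrable_const _).indicator measurableSet_Ici)
    (h.integrable_one_sub_exp a hi) ?_
  filter_upwards [h.nonneg a] with z hz
  by_cases hzδ : z ∈ Ici δ
  · rw [indicator_of_mem hzδ]
    have : 1 ≤ δ⁻¹ * z := by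
      rw [inv_mul_eq_div, one_le_div hδ]; exact hzδ
    have := Real.exp_le_exp.2 (neg_le_neg this)
    linarith
  · rw [indicator_of_notMem hzδ]
    exact one_sub_exp_nonneg hi hz

lemma measure_Iio_nsmul_le (h : IsSubordinatorLaw m β ν) (a : ℝ≥0) (c : ℝ) (n : ℕ) :
    m (n • a) (Iio c) ≤ (m a (Iio c)) ^ n := by
  induction n with
  | zero =>
    have hp : IsProbabilityMeasure (m (0 • a)) := h.isProbability (0 • a)
    rw [pow_zero]
    exact prob_le_one
  | succ n ih =>
    rw [succ_nsmul, pow_succ]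
    exact (h.measure_Iio_add_le _ _ _).trans (by gcongr)

end IsSubordinatorLaw

/-! ### Weak convergence of the rescaled laws -/

/-- The measure `(1 - e^{-z}) m_a(dz) / a`. -/
noncomputable def scaledLaw (m : ℝ≥0 → Measure ℝ) (a : ℝ≥0) : Measure ℝ :=
  (m a).withDensity fun z => ENNReal.ofReal ((1 - Real.exp (-z)) / a)

/-- The measure `β δ_0 + (1 - e^{-z}) ν(dz)`. -/
noncomputable def canonicalMeasure (β : ℝ) (ν : Measure ℝ) : Measure ℝ :=
  ENNReal.ofReal β • Measure.dirac 0 +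
    (ν.restrict (Ioi 0)).withDensity fun z => ENNReal.ofReal (1 - Real.exp (-z))

/-- The function `e^{-z⁺}`. -/
noncomputable def expNegPos (z : ℝ) : ℝ := Real.exp (-(max z 0))

@[fun_prop]
lemma continuous_expNegPos : Continuous expNegPos := by unfold expNegPos; fun_prop

lemma expNegPos_pos (z : ℝ) : 0 < expNegPos z := Real.exp_pos _

lemma expNegPos_le_one (z : ℝ) : expNegPos z ≤ 1 := Real.exp_le_one_iff.2 (by simp)

lemma expNegPos_antitone : Antitone expNegPos := fun _ _ h =>
  Real.exp_le_exp.2 (neg_le_neg (max_le_max_right 0 h))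

lemma expNegPos_of_nonneg {z : ℝ} (hz : 0 ≤ z) : expNegPos z = Real.exp (-z) := by
  rw [expNegPos, max_eq_left hz]

namespace IsSubordinatorLevyMeasure

variable {ν : Measure ℝ} {β : ℝ}

lemma isFiniteMeasure_canonicalMeasure (h : IsSubordinatorLevyMeasure ν) :
    IsFiniteMeasure (canonicalMeasure β ν) := by
  have h1 : IsFiniteMeasure ((ν.restrict (Ioi 0)).withDensity
      fun z => ENNReal.ofReal (1 - Real.exp (-z))) := by
    have := h.integrableOn_exp zero_le_one
    simp only [one_mul] at this
    exact isFiniteMeasure_withDensity_ofReal this.2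
  have h2 : IsFiniteMeasure (ENNReal.ofReal β • Measure.dirac (0 : ℝ)) :=
    Measure.smul_finite _ ENNReal.ofReal_ne_top
  unfold canonicalMeasure
  infer_instance

lemma canonicalMeasure_nonneg : ∀ᵐ z ∂canonicalMeasure β ν, 0 ≤ z := by
  rw [canonicalMeasure, ae_add_measure_iff]
  refine ⟨Measure.ae_smul_measure ?_ _, ?_⟩
  · rw [ae_dirac_iff measurableSet_Ici]
  · refine (withDensity_absolutelyContinuous _ _).ae_le ?_
    filter_upwards [ae_restrict_mem measurableSet_Ioi] with z hz using le_of_lt hz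

lemma integrable_canonicalMeasure_iff {φ : ℝ → ℝ} (h : Integrable φ (canonicalMeasure β ν)) :
    IntegrableOn (fun z => (1 - Real.exp (-z)) * φ z) (Ioi 0) ν := by
  rw [canonicalMeasure] at h
  have h2 := h.right_of_add_measure
  rw [integrable_withDensity_iff_integrable_smul' (by fun_prop) (by simp)] at h2
  refine h2.congr ?_
  filter_upwards [ae_restrict_mem measurableSet_Ioi] with z hz
  have := one_sub_exp_nonneg zero_le_one (le_of_lt hz)
  rw [one_mul] at this
  rw [ENNReal.toReal_ofReal this, smul_eq_mul]

lemma integral_canonicalMeasure (hβ : 0 ≤ β) {φ : ℝ → ℝ}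
    (h : Integrable φ (canonicalMeasure β ν)) :
    ∫ z, φ z ∂canonicalMeasure β ν =
      β * φ 0 + ∫ z in Ioi 0, (1 - Real.exp (-z)) * φ z ∂ν := by
  rw [canonicalMeasure] at h ⊢
  rw [integral_add_measure h.left_of_add_measure h.right_of_add_measure, integral_smul_measure,
    integral_dirac, ENNReal.toReal_ofReal hβ, smul_eq_mul,
    integral_withDensity_eq_integral_toReal_smul (by fun_prop) (by simp)]
  congr 1
  refine setIntegral_congr_fun measurableSet_Ioi fun z hz => ?_
  have := one_sub_exp_nonneg zero_le_one (le_of_lt hz)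
  rw [one_mul] at this
  simp only [ENNReal.toReal_ofReal this, smul_eq_mul]

end IsSubordinatorLevyMeasure

lemma integrable_of_bounded {κ : Measure ℝ} [IsFiniteMeasure κ] {φ : ℝ → ℝ} (hφ : Measurable φ)
    {C : ℝ} (hC : ∀ z, |φ z| ≤ C) : Integrable φ κ :=
  (integrable_const C).mono' hφ.aestronglyMeasurable (.of_forall hC)

namespace IsSubordinatorLaw

variable {m : ℝ≥0 → Measure ℝ} {β : ℝ} {ν : Measure ℝ}

lemma isFiniteMeasure_scaledLaw (h : IsSubordinatorLaw m β ν) (a : ℝ≥0) :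
    IsFiniteMeasure (scaledLaw m a) := by
  have := h.isProbability a
  have h1 : Integrable (fun z => (1 - Real.exp (-z)) / a) (m a) := by
    have := (h.integrable_exp a zero_le_one)
    simp only [one_mul] at this
    exact ((integrable_const _).sub this).div_const _
  exact isFiniteMeasure_withDensity_ofReal h1.2

lemma integral_scaledLaw (h : IsSubordinatorLaw m β ν) (a : ℝ≥0) (φ : ℝ → ℝ) :
    ∫ z, φ z ∂scaledLaw m a = (∫ z, (1 - Real.exp (-z)) * φ z ∂(m a)) / a := by
  rw [scaledLaw, integral_withDensity_eq_integral_toReal_smul (by fun_prop) (by simp),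
    ← integral_div]
  refine integral_congr_ae ?_
  filter_upwards [h.nonneg a] with z hz
  have := one_sub_exp_nonneg zero_le_one hz
  rw [one_mul] at this
  rw [ENNReal.toReal_ofReal (by positivity), smul_eq_mul]
  ring

/-- For `z ≥ 0`, `(1 - e^{-z}) e^{-nz}` is the difference of `1 - e^{-(n+1)z}` and `1 - e^{-nz}`.
The moments of both measures are therefore expressed through the Laplace exponent at consecutive
integers. -/
lemma tendsto_integral_pow (h : IsSubordinatorLaw m β ν) (n : ℕ) :
    Tendsto (fun a => ∫ z, expNegPos z ^ n ∂scaledLaw m a) (𝓝[>] 0)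
      (𝓝 (∫ z, expNegPos z ^ n ∂canonicalMeasure β ν)) := by
  have := h.levyMeasure.isFiniteMeasure_canonicalMeasure (β := β)
  have hn : (0 : ℝ) ≤ n := n.cast_nonneg
  have hn1 : (0 : ℝ) ≤ n + 1 := by positivity
  have key : ∀ z : ℝ, 0 ≤ z → (1 - Real.exp (-z)) * expNegPos z ^ n
      = (1 - Real.exp (-((n + 1 : ℝ) * z))) - (1 - Real.exp (-((n : ℝ) * z))) := by
    intro z hz
    rw [expNegPos_of_nonneg hz, ← Real.exp_nat_mul, one_sub_mul, ← Real.exp_add]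
    ring_nf
  have hint : Integrable (fun z => expNegPos z ^ n) (canonicalMeasure β ν) :=
    integrable_of_bounded (C := 1) (by fun_prop) fun z => by
      rw [abs_of_nonneg (pow_nonneg (expNegPos_pos z).le n)]
      exact pow_le_one₀ (expNegPos_pos z).le (expNegPos_le_one z)
  have hlim : ∫ z, expNegPos z ^ n ∂canonicalMeasure β ν
      = laplaceExponent β ν (n + 1) - laplaceExponent β ν n := by
    rw [IsSubordinatorLevyMeasure.integral_canonicalMeasure h.drift_nonneg hint,
      setIntegral_congr_fun measurableSet_Ioi fun z hz => key z (le_of_lt hz),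
      integral_sub (h.levyMeasure.integrableOn_exp hn1) (h.levyMeasure.integrableOn_exp hn)]
    simp [laplaceExponent, expNegPos]
    ring
  rw [hlim]
  refine ((h.tendsto_integral_one_sub_exp hn1).sub (h.tendsto_integral_one_sub_exp hn)).congr
    fun a => ?_
  have := h.isProbability a
  rw [h.integral_scaledLaw, ← sub_div, ← integral_sub
    (h.integrable_one_sub_exp a hn1) (h.integrable_one_sub_exp a hn)]
  congr 1
  refine integral_congr_ae ?_
  filter_upwards [h.nonneg a] with z hz using (key z hz).symm

/-- Weak convergence of `(1 - e^{-z}) m_a(dz) / a` on the compactified half-line. -/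
lemma tendsto_integral_comp_expNegPos (h : IsSubordinatorLaw m β ν) {φ : ℝ → ℝ}
    (hφ : Continuous φ) :
    Tendsto (fun a => ∫ z, φ (expNegPos z) ∂scaledLaw m a) (𝓝[>] 0)
      (𝓝 (∫ z, φ (expNegPos z) ∂canonicalMeasure β ν)) := by
  have hK := h.levyMeasure.isFiniteMeasure_canonicalMeasure (β := β)
  have hKa := h.isFiniteMeasure_scaledLaw
  have hmem : ∀ z, expNegPos z ∈ Icc (0 : ℝ) 1 := fun z =>
    ⟨(expNegPos_pos z).le, expNegPos_le_one z⟩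
  have hint : ∀ (κ : Measure ℝ) [IsFiniteMeasure κ] (g : ℝ → ℝ), Continuous g →
      Integrable (fun z => g (expNegPos z)) κ := by
    intro κ _ g hg
    obtain ⟨C, hC⟩ := (isCompact_Icc (a := (0 : ℝ)) (b := 1)).exists_bound_of_continuousOn
      hg.continuousOn
    exact integrable_of_bounded (C := C) (by fun_prop) fun z => hC _ (hmem z)
  have hpoly : ∀ p : Polynomial ℝ, Tendsto (fun a => ∫ z, p.eval (expNegPos z) ∂scaledLaw m a)
      (𝓝[>] 0) (𝓝 (∫ z, p.eval (expNegPos z) ∂canonicalMeasure β ν)) := by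
    intro p
    have hrw : ∀ (κ : Measure ℝ) [IsFiniteMeasure κ], ∫ z, p.eval (expNegPos z) ∂κ
        = ∑ i ∈ Finset.range (p.natDegree + 1), p.coeff i * ∫ z, expNegPos z ^ i ∂κ := by
      intro κ _
      simp_rw [Polynomial.eval_eq_sum_range]
      rw [integral_finsetSum]
      · simp_rw [integral_const_mul]
      · exact fun i _ => (hint κ (fun w => w ^ i) (by fun_prop)).const_mul _
    simp_rw [hrw]
    exact tendsto_finsetSum _ fun i _ => (h.tendsto_integral_pow i).const_mul _
  have hmass : Tendsto (fun a => (scaledLaw m a).real univ) (𝓝[>] 0)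
      (𝓝 ((canonicalMeasure β ν).real univ)) := by
    simpa using h.tendsto_integral_pow 0
  set M := (canonicalMeasure β ν).real univ + 1 with hM
  have hMpos : 0 < M := by positivity
  rw [Metric.tendsto_nhds]
  intro ε hε
  obtain ⟨p, hp⟩ := exists_polynomial_near_of_continuousOn 0 1 φ hφ.continuousOn
    (ε / (3 * M)) (by positivity)
  have hclose : ∀ (κ : Measure ℝ) [IsFiniteMeasure κ], κ.real univ < M →
      |∫ z, φ (expNegPos z) ∂κ - ∫ z, p.eval (expNegPos z) ∂κ| ≤ ε / 3 := by
    intro κ _ hκ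
    rw [← integral_sub (hint κ φ hφ) (hint κ _ p.continuous)]
    have := norm_integral_le_of_norm_le_const (μ := κ)
      (f := fun z => φ (expNegPos z) - p.eval (expNegPos z)) (C := ε / (3 * M))
      (.of_forall fun z => by
        rw [Real.norm_eq_abs, abs_sub_comm]; exact (hp _ (hmem z)).le)
    rw [Real.norm_eq_abs] at this
    refine this.trans ?_
    calc ε / (3 * M) * κ.real univ ≤ ε / (3 * M) * M := by gcongr
      _ = ε / 3 := by field_simp
  filter_upwards [Metric.tendsto_nhds.1 (hpoly p) (ε / 3) (by positivity),
    hmass.eventually_lt_const (show _ < M by linarith)] with a h1 h2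
  have h3 := hclose (scaledLaw m a) h2
  have h4 := hclose (canonicalMeasure β ν) (by linarith)
  rw [Real.dist_eq] at h1 ⊢
  rw [abs_le] at h3 h4
  rw [abs_lt] at h1 ⊢
  constructor <;> linarith [h1.1, h1.2, h3.1, h3.2, h4.1, h4.2]

/-- Asymptotic lower bound for tails, away from the boundary point. -/
lemma eventually_measure_Ici_ge (h : IsSubordinatorLaw m β ν) {δ b : ℝ} (hδ : 0 < δ) (hδb : δ < b)
    {ε : ℝ} (hε : 0 < ε) :
    ∀ᶠ a : ℝ≥0 in 𝓝[>] 0, ν.real (Ici b) - ε ≤ (m a).real (Ici δ) / a := by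
  have hK := h.levyMeasure.isFiniteMeasure_canonicalMeasure (β := β)
  have hb : 0 < b := hδ.trans hδb
  have hνb := h.levyMeasure.measure_Ici_lt_top hb
  set d := Real.exp (-δ) - Real.exp (-b) with hd
  have hdpos : 0 < d := by rw [hd, sub_pos]; exact Real.exp_lt_exp.2 (by linarith)
  have hδ1 : Real.exp (-δ) < 1 := by
    rw [← Real.exp_zero]; exact Real.exp_lt_exp.2 (by linarith)
  -- In the variable `w = e^{-z}`, `c` is a continuous cutoff equal to `1` for `z ≥ b` and to `0`
  -- for `z ≤ δ`. Weak convergence needs this gap between `δ` and `b`.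
  set c := fun w : ℝ => max 0 (min 1 ((Real.exp (-δ) - w) / d)) with hc
  -- Division by `1 - w` cancels the density of the rescaled measures. The maximum keeps the
  -- denominator away from `0` and changes nothing in the product, since `c` vanishes where it is
  -- active.
  set φ := fun w : ℝ => c w / max (1 - w) (1 - Real.exp (-δ)) with hφ
  have hden : ∀ w : ℝ, 0 < max (1 - w) (1 - Real.exp (-δ)) := fun w =>
    lt_max_of_lt_right (by linarith)
  have hφc : Continuous φ := by
    refine Continuous.div (by fun_prop) (by fun_prop) fun w => (hden w).ne'
  have hprod : ∀ z : ℝ, 0 ≤ z → (1 - Real.exp (-z)) * φ (expNegPos z) = c (Real.exp (-z)) := by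
    intro z hz
    rw [expNegPos_of_nonneg hz]
    simp only [hφ]
    rcases le_total δ z with hz' | hz'
    · have h1 : Real.exp (-z) ≤ Real.exp (-δ) := Real.exp_le_exp.2 (by linarith)
      rw [max_eq_left (by linarith)]
      have : 1 - Real.exp (-z) ≠ 0 := by linarith
      field_simp
    · have h1 : Real.exp (-δ) ≤ Real.exp (-z) := Real.exp_le_exp.2 (by linarith)
      have : c (Real.exp (-z)) = 0 := by
        refine max_eq_left (min_le_of_right_le ?_)
        exact div_nonpos_of_nonpos_of_nonneg (by linarith) hdpos.le
      rw [this]; simp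
  have hc_one : ∀ z, b ≤ z → c (Real.exp (-z)) = 1 := by
    intro z hz
    have h1 : Real.exp (-z) ≤ Real.exp (-b) := Real.exp_le_exp.2 (by linarith)
    have : 1 ≤ (Real.exp (-δ) - Real.exp (-z)) / d := by
      rw [one_le_div hdpos]; linarith
    simp only [hc]
    rw [min_eq_left this]; simp
  have hc0 : ∀ w, 0 ≤ c w := fun w => le_max_left _ _
  have hc1 : ∀ w, c w ≤ 1 := fun w => max_le zero_le_one (min_le_left _ _)
  have hc_zero : ∀ z, z < δ → c (Real.exp (-z)) = 0 := by
    intro z hz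
    refine max_eq_left (min_le_of_right_le ?_)
    have h1 : Real.exp (-δ) ≤ Real.exp (-z) := Real.exp_le_exp.2 (by linarith)
    exact div_nonpos_of_nonpos_of_nonneg (by linarith) hdpos.le
  have hint : Integrable (fun z => φ (expNegPos z)) (canonicalMeasure β ν) := by
    obtain ⟨C, hC⟩ := (isCompact_Icc (a := (0 : ℝ)) (b := 1)).exists_bound_of_continuousOn
      hφc.continuousOn
    exact integrable_of_bounded (C := C) (by fun_prop) fun z =>
      hC _ ⟨(expNegPos_pos z).le, expNegPos_le_one z⟩
  have hlow : ν.real (Ici b) ≤ ∫ z, φ (expNegPos z) ∂canonicalMeasure β ν := by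
    have hon := IsSubordinatorLevyMeasure.integrable_canonicalMeasure_iff hint
    rw [IsSubordinatorLevyMeasure.integral_canonicalMeasure h.drift_nonneg hint]
    have h0 : 0 ≤ β * φ (expNegPos 0) :=
      mul_nonneg h.drift_nonneg (div_nonneg (hc0 _) (hden _).le)
    have h1 : ν.real (Ici b) = ∫ z in Ici b, (1 - Real.exp (-z)) * φ (expNegPos z) ∂ν := by
      rw [setIntegral_congr_fun (g := fun _ => (1 : ℝ)) measurableSet_Ici fun z hz => by
        simp only; rw [hprod z (hb.le.trans hz), hc_one z hz]]
      simp
    rw [h1]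
    refine (setIntegral_mono_set hon ?_ ?_).trans (le_add_of_nonneg_left h0)
    · filter_upwards [ae_restrict_mem measurableSet_Ioi] with z hz
      rw [hprod z (le_of_lt hz)]; exact hc0 _
    · exact (show Ici b ⊆ Ioi 0 from fun z hz => hb.trans_le hz).eventuallyLE
  filter_upwards [(h.tendsto_integral_comp_expNegPos hφc).eventually_const_lt
    (show ν.real (Ici b) - ε < _ by linarith), self_mem_nhdsWithin] with a ha ha0
  refine ha.le.trans ?_
  rw [h.integral_scaledLaw]
  refine div_le_div_of_nonneg_right ?_ a.coe_nonneg
  have := h.isProbability a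
  have h1 : (m a).real (Ici δ) = ∫ z, (Ici δ).indicator (fun _ => (1 : ℝ)) z ∂(m a) := by
    rw [integral_indicator measurableSet_Ici]; simp
  rw [h1]
  refine integral_mono_of_nonneg ?_ ((integrable_const _).indicator measurableSet_Ici) ?_
  · filter_upwards [h.nonneg a] with z hz
    rw [hprod z hz]; exact hc0 _
  · filter_upwards [h.nonneg a] with z hz
    rw [hprod z hz]
    by_cases hzδ : z ∈ Ici δ
    · rw [indicator_of_mem hzδ]; exact hc1 _
    · rw [indicator_of_notMem hzδ, hc_zero z (not_le.1 hzδ)]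

end IsSubordinatorLaw

/-! ### From monotone to right-continuous integrands -/

/-- Convergence of integrals of right-continuous functions follows from asymptotic lower bounds
for monotone functions. -/
lemma tendsto_integral_of_monotone {ι : Type*} {l : Filter ι} {κi : ι → Measure ℝ} {κ : Measure ℝ}
    [∀ i, IsFiniteMeasure (κi i)] [IsFiniteMeasure κ]
    (h0 : ∀ᵐ z ∂κ, 0 ≤ z)
    (hmono : ∀ Φ : ℝ → ℝ, Monotone Φ → ∀ C, (∀ z, |Φ z| ≤ C) → ∀ ε > 0,
      ∀ᶠ i in l, ∫ z, Φ z ∂κ - ε ≤ ∫ z, Φ z ∂κi i)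
    (hexp : Tendsto (fun i => ∫ z, expNegPos z ∂κi i) l (𝓝 (∫ z, expNegPos z ∂κ)))
    {ψ : ℝ → ℝ} (hψ : Measurable ψ) {C : ℝ} (hC : ∀ z, |ψ z| ≤ C)
    (hr : ∀ z, 0 ≤ z → ContinuousWithinAt ψ (Ici z) z) :
    Tendsto (fun i => ∫ z, ψ z ∂κi i) l (𝓝 (∫ z, ψ z ∂κ)) := by
  have lower : ∀ ψ : ℝ → ℝ, Measurable ψ → (∀ z, |ψ z| ≤ C) →
      (∀ z, 0 ≤ z → ContinuousWithinAt ψ (Ici z) z) → ∀ ε > 0,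
      ∀ᶠ i in l, ∫ z, ψ z ∂κ - ε ≤ ∫ z, ψ z ∂κi i := by
    intro ψ hψ hC hr ε hε
    have hexpint : ∀ (κ : Measure ℝ) [IsFiniteMeasure κ], Integrable expNegPos κ := fun κ _ =>
      integrable_of_bounded (C := 1) (by fun_prop) fun z => by
        rw [abs_of_nonneg (expNegPos_pos z).le]; exact expNegPos_le_one z
    -- A one-sided inf-convolution. The infimum over `w ≥ z` is monotone in `z`, and `Φ n + n
    -- e^{-z⁺}` stays between `-C` and `ψ`. Moving from `z` to `w ≥ z + η` costs at least `n (e^{-z}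
    -- - e^{-(z+η)})`, which exceeds `2C` for large `n`. Hence only values of `ψ` just to the right
    -- of `z` matter, and right-continuity gives convergence to `ψ z`.
    set Φ : ℕ → ℝ → ℝ := fun n z => ⨅ w : Ici z, (ψ w - n * expNegPos w) with hΦ
    have hlow : ∀ (n : ℕ) (w : ℝ), -C - n ≤ ψ w - n * expNegPos w := by
      intro n w
      have h1 := (abs_le.1 (hC w)).1
      have h2 : n * expNegPos w ≤ n * 1 :=
        mul_le_mul_of_nonneg_left (expNegPos_le_one w) n.cast_nonneg
      linarith
    have hbdd : ∀ (n : ℕ) (z : ℝ), BddBelow (range fun w : Ici z => ψ w - n * expNegPos w) :=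
      fun n z => ⟨-C - n, by rintro _ ⟨w, rfl⟩; exact hlow n w⟩
    have hΦle : ∀ (n : ℕ) (z w : ℝ), z ≤ w → Φ n z ≤ ψ w - n * expNegPos w := fun n z w hzw =>
      ciInf_le (hbdd n z) (⟨w, hzw⟩ : Ici z)
    have hΦmono : ∀ n, Monotone (Φ n) := fun n x y hxy =>
      le_ciInf fun w => hΦle n x w (hxy.trans w.2)
    have hΦbdd : ∀ n z, |Φ n z| ≤ C + n := by
      intro n z
      rw [abs_le]
      constructor
      · have : -C - n ≤ Φ n z := le_ciInf fun w => hlow n w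
        linarith
      · have h1 := hΦle n z z le_rfl
        have h2 := (abs_le.1 (hC z)).2
        have h3 : 0 ≤ n * expNegPos z := mul_nonneg n.cast_nonneg (expNegPos_pos z).le
        have h4 : (0 : ℝ) ≤ n := n.cast_nonneg
        linarith
    set g : ℕ → ℝ → ℝ := fun n z => Φ n z + n * expNegPos z with hg
    have hgle : ∀ n z, g n z ≤ ψ z := fun n z => by
      have := hΦle n z z le_rfl
      simp only [hg]; linarith
    have hgge : ∀ n z, -C ≤ g n z := by
      intro n z
      have : -C - n * expNegPos z ≤ Φ n z := le_ciInf fun w => by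
        have h1 := (abs_le.1 (hC w)).1
        have h2 : n * expNegPos w ≤ n * expNegPos z :=
          mul_le_mul_of_nonneg_left (expNegPos_antitone w.2) n.cast_nonneg
        linarith
      simp only [hg]; linarith
    have hgmeas : ∀ n, Measurable (g n) := fun n => (hΦmono n).measurable.add (by fun_prop)
    have hglim : ∀ z, 0 ≤ z → Tendsto (fun n => g n z) atTop (𝓝 (ψ z)) := by
      intro z hz
      rw [Metric.tendsto_atTop]
      intro ε hε
      have hev := Metric.tendsto_nhds.1 (hr z hz) (ε / 2) (by positivity)
      obtain ⟨η, hη, hball⟩ := Metric.mem_nhdsWithin_iff.1 hev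
      have hd : 0 < expNegPos z - expNegPos (z + η) := by
        rw [expNegPos_of_nonneg hz, expNegPos_of_nonneg (by linarith), sub_pos]
        exact Real.exp_lt_exp.2 (by linarith)
      obtain ⟨N, hN⟩ := exists_nat_ge (2 * C / (expNegPos z - expNegPos (z + η)))
      refine ⟨N, fun n hn => ?_⟩
      have hn' : 2 * C ≤ n * (expNegPos z - expNegPos (z + η)) := by
        rw [div_le_iff₀ hd] at hN
        refine hN.trans ?_
        gcongr
      have hge : ψ z - ε / 2 ≤ g n z := by
        have : ψ z - ε / 2 - n * expNegPos z ≤ Φ n z := le_ciInf fun w => by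
          have hw : z ≤ w := w.2
          rcases lt_or_ge (w : ℝ) (z + η) with hwη | hwη
          · have hmem : (w : ℝ) ∈ Metric.ball z η ∩ Ici z :=
              ⟨by rw [Metric.mem_ball, Real.dist_eq, abs_of_nonneg] <;> linarith, hw⟩
            have h1 : dist (ψ w) (ψ z) < ε / 2 := hball hmem
            rw [Real.dist_eq, abs_lt] at h1
            have h2 : n * expNegPos w ≤ n * expNegPos z :=
              mul_le_mul_of_nonneg_left (expNegPos_antitone hw) n.cast_nonneg
            linarith
          · have h1 := (abs_le.1 (hC w)).1
            have h2 := (abs_le.1 (hC z)).2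
            have h3 : n * expNegPos w ≤ n * expNegPos (z + η) :=
              mul_le_mul_of_nonneg_left (expNegPos_antitone hwη) n.cast_nonneg
            linarith
        simp only [hg]; linarith
      rw [Real.dist_eq, abs_lt]
      constructor <;> linarith [hgle n z]
    have hgbdd : ∀ n z, |g n z| ≤ C := fun n z =>
      abs_le.2 ⟨hgge n z, (hgle n z).trans (abs_le.1 (hC z)).2⟩
    have hglim' : Tendsto (fun n => ∫ z, g n z ∂κ) atTop (𝓝 (∫ z, ψ z ∂κ)) :=
      tendsto_integral_of_dominated_convergence (fun _ => C)
        (fun n => (hgmeas n).aestronglyMeasurable) (integrable_const _)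
        (fun n => .of_forall (hgbdd n)) (h0.mono fun z hz => hglim z hz)
    obtain ⟨n, hn⟩ := (hglim'.eventually_const_lt
      (show ∫ z, ψ z ∂κ - ε / 3 < _ by linarith)).exists
    have hsplit : ∀ (κ : Measure ℝ) [IsFiniteMeasure κ],
        ∫ z, g n z ∂κ = ∫ z, Φ n z ∂κ + n * ∫ z, expNegPos z ∂κ := fun κ _ => by
      rw [← integral_const_mul, ← integral_add
        (integrable_of_bounded (hΦmono n).measurable (hΦbdd n)) ((hexpint κ).const_mul _)]
    filter_upwards [hmono (Φ n) (hΦmono n) _ (hΦbdd n) (ε / 3) (by positivity),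
      (hexp.const_mul (n : ℝ)).eventually_const_lt
        (show n * ∫ z, expNegPos z ∂κ - ε / 3 < _ by linarith)] with i h1 h2
    have h3 : ∫ z, g n z ∂κi i ≤ ∫ z, ψ z ∂κi i :=
      integral_mono (integrable_of_bounded (hgmeas n) (hgbdd n)) (integrable_of_bounded hψ hC)
        (hgle n)
    rw [hsplit] at h3 hn
    linarith
  rw [Metric.tendsto_nhds]
  intro ε hε
  -- Right-continuity and boundedness are stable under negation, so the lower bound for `-ψ` is the
  -- upper bound for `ψ`.
  filter_upwards [lower ψ hψ hC hr (ε / 2) (by positivity),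
    lower (fun z => -ψ z) hψ.neg (fun z => by rw [abs_neg]; exact hC z)
      (fun z hz => (hr z hz).neg) (ε / 2) (by positivity)] with i h1 h2
  rw [integral_neg, integral_neg] at h2
  rw [Real.dist_eq, abs_lt]
  constructor <;> linarith

/-! ### Sharp tail bounds and the generator of a subordinator at `0` -/

namespace IsSubordinatorLaw

variable {m : ℝ≥0 → Measure ℝ} {β : ℝ} {ν : Measure ℝ}

/-- Cut `[0, a]` into `n` equal pieces: to stay below `δ`, every increment must do so. Each has
probability `q ≥ (a/n)(ν[b,∞) - ε)` of reaching `δ` for large `n`, and `(1 - q)^n ≤ e^{-nq}`; then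
`ε ↓ 0`. -/
lemma measureReal_Iio_le_of_lt (h : IsSubordinatorLaw m β ν) {a : ℝ≥0} (ha : 0 < a) {δ b : ℝ}
    (hδ : 0 < δ) (hδb : δ < b) :
    (m a).real (Iio δ) ≤ Real.exp (-(a * ν.real (Ici b))) := by
  have key : ∀ ε > 0, (m a).real (Iio δ) ≤ Real.exp (-(a * (ν.real (Ici b) - ε))) := by
    intro ε hε
    have hlim : Tendsto (fun n : ℕ => a / n) atTop (𝓝[>] 0) := by
      refine tendsto_nhdsWithin_iff.2 ⟨?_, ?_⟩
      · exact tendsto_const_div_atTop_nhds_zero_nat a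
      · filter_upwards [eventually_gt_atTop 0] with n hn
        exact div_pos ha (by exact_mod_cast hn)
    obtain ⟨n, hn, hn0⟩ := ((hlim.eventually (h.eventually_measure_Ici_ge hδ hδb hε)).and
      (eventually_gt_atTop 0)).exists
    have hnr : (0 : ℝ) < n := by exact_mod_cast hn0
    have har : (0 : ℝ) < a := by exact_mod_cast ha
    set q := (m (a / n)).real (Ici δ) with hq
    have hq1 : (m (a / n)).real (Iio δ) = 1 - q := by
      have := h.isProbability (a / n)
      rw [hq, ← probReal_compl_eq_one_sub measurableSet_Ici, compl_Ici]
    have h1 : (m a).real (Iio δ) ≤ (1 - q) ^ n := by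
      have := h.measure_Iio_nsmul_le (a / n) δ n
      rw [nsmul_eq_mul, mul_div_cancel₀ _ (by exact_mod_cast hn0.ne')] at this
      rw [← hq1, measureReal_def, measureReal_def, ← ENNReal.toReal_pow]
      have := h.isProbability (a / n)
      exact ENNReal.toReal_mono (by finiteness) ‹_›
    refine h1.trans ?_
    have h2 : 0 ≤ 1 - q := hq1 ▸ measureReal_nonneg
    have h3 : 1 - q ≤ Real.exp (-q) := by linarith [Real.add_one_le_exp (-q)]
    refine (pow_le_pow_left₀ h2 h3 n).trans ?_
    rw [← Real.exp_nat_mul, Real.exp_le_exp]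
    rw [NNReal.coe_div, NNReal.coe_natCast, le_div_iff₀ (by positivity)] at hn
    have : (ν.real (Ici b) - ε) * (a / n) * n = a * (ν.real (Ici b) - ε) := by
      field_simp
    nlinarith [mul_le_mul_of_nonneg_right hn hnr.le]
  have hc : Tendsto (fun ε : ℝ => Real.exp (-(a * (ν.real (Ici b) - ε)))) (𝓝[>] 0)
      (𝓝 (Real.exp (-(a * (ν.real (Ici b) - 0))))) :=
    (Continuous.tendsto (by fun_prop) 0).mono_left nhdsWithin_le_nhds
  rw [sub_zero] at hc
  refine ge_of_tendsto hc ?_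
  filter_upwards [self_mem_nhdsWithin] with ε hε using key ε hε

/-- At each time, a subordinator has passed the level `b` with at least the probability that it
has made a jump of size at least `b`. -/
lemma one_sub_exp_le_measureReal_Ici (h : IsSubordinatorLaw m β ν) (a : ℝ≥0) {b : ℝ} (hb : 0 < b) :
    1 - Real.exp (-(a * ν.real (Ici b))) ≤ (m a).real (Ici b) := by
  have := h.isProbability a
  rcases eq_or_ne a 0 with rfl | ha
  · simp
  have hIio : (m a) (Iio b) ≤ ENNReal.ofReal (Real.exp (-(a * ν.real (Ici b)))) := by
    -- At the fixed time `a`, the loss between `δ` and `b` disappears by letting `δ ↑ b`: the sets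
    -- `(-∞, δ)` increase to `(-∞, b)`. A possible atom of `ν` at `b` is thus kept.
    obtain ⟨u, hu, hub, hlim⟩ := exists_seq_strictMono_tendsto' hb
    have hU : Iio b = ⋃ n, Iio (u n) := by
      ext x
      simp only [mem_Iio, mem_iUnion]
      exact ⟨fun hx => (hlim.eventually_const_lt hx).exists,
        fun ⟨n, hn⟩ => hn.trans (hub n).2⟩
    rw [hU, Monotone.measure_iUnion fun i j hij => Iio_subset_Iio (hu.monotone hij)]
    refine iSup_le fun n => ?_
    rw [← ofReal_measureReal]
    exact ENNReal.ofReal_le_ofReal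
      (h.measureReal_Iio_le_of_lt (pos_iff_ne_zero.2 ha) (hub n).1 (hub n).2)
  have h1 : (m a).real (Iio b) ≤ Real.exp (-(a * ν.real (Ici b))) :=
    ENNReal.toReal_le_of_le_ofReal (Real.exp_pos _).le hIio
  rw [← compl_Ici, probReal_compl_eq_one_sub measurableSet_Ici] at h1
  linarith

lemma measure_Ici_le_liminf (h : IsSubordinatorLaw m β ν) {b : ℝ} (hb : 0 < b) :
    ν (Ici b) ≤ liminf (fun a : ℝ≥0 => (a : ℝ≥0∞)⁻¹ * m a (Ici b)) (𝓝[>] 0) := by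
  have h1 : Tendsto (fun a : ℝ≥0 => ENNReal.ofReal ((1 - Real.exp (-(a * ν.real (Ici b)))) / a))
      (𝓝[>] 0) (𝓝 (ν (Ici b))) := by
    have := (ENNReal.continuous_ofReal.tendsto _).comp (tendsto_one_sub_exp_div (ν.real (Ici b)))
    rwa [ofReal_measureReal (h.levyMeasure.measure_Ici_lt_top hb).ne] at this
  rw [← h1.liminf_eq]
  refine liminf_le_liminf ?_
  filter_upwards [self_mem_nhdsWithin] with a ha
  have := h.isProbability a
  have ha0 : (0 : ℝ) < a := by exact_mod_cast ha
  rw [div_eq_inv_mul, ENNReal.ofReal_mul (by positivity), ENNReal.ofReal_inv_of_pos ha0,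
    ENNReal.ofReal_coe_nnreal, ← ofReal_measureReal]
  gcongr
  exact h.one_sub_exp_le_measureReal_Ici a hb

/-- An upper set without minimum is the directed union of the half-lines `[q, ∞)` with `q` rational
in it, so continuity of `ν` from below reduces to closed half-lines. -/
lemma measure_isUpperSet_le_liminf (h : IsSubordinatorLaw m β ν) {U : Set ℝ} (hU : IsUpperSet U)
    (hpos : U ⊆ Ioi 0) :
    ν U ≤ liminf (fun a : ℝ≥0 => (a : ℝ≥0∞)⁻¹ * m a U) (𝓝[>] 0) := by
  by_cases hmin : ∃ b ∈ U, ∀ x ∈ U, b ≤ x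
  · obtain ⟨b, hbU, hb⟩ := hmin
    have : U = Ici b := Subset.antisymm hb fun x hx => hU hx hbU
    rw [this]
    exact h.measure_Ici_le_liminf (hpos hbU)
  · push Not at hmin
    have hUq : U = ⋃ q ∈ {q : ℚ | (q : ℝ) ∈ U}, Ici (q : ℝ) := by
      ext x
      simp only [mem_iUnion, mem_ofPred_eq, exists_prop, mem_Ici]
      constructor
      · intro hx
        obtain ⟨y, hy, hyx⟩ := hmin x hx
        obtain ⟨q, hq1, hq2⟩ := exists_rat_btwn hyx
        exact ⟨q, hU hq1.le hy, hq2.le⟩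
      · rintro ⟨q, hq, hqx⟩
        exact hU hqx hq
    have hdir : DirectedOn ((fun q : ℚ => Ici (q : ℝ)) ⁻¹'o (· ⊆ ·)) {q : ℚ | (q : ℝ) ∈ U} := by
      intro p hp q hq
      rcases le_total p q with hpq | hpq
      · exact ⟨p, hp, subset_rfl, Ici_subset_Ici.2 (by exact_mod_cast hpq)⟩
      · exact ⟨q, hq, Ici_subset_Ici.2 (by exact_mod_cast hpq), subset_rfl⟩
    have hν : ν U = ⨆ q ∈ {q : ℚ | (q : ℝ) ∈ U}, ν (Ici (q : ℝ)) := by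
      conv_lhs => rw [hUq]
      exact measure_biUnion_eq_iSup (to_countable _) hdir
    rw [hν]
    refine iSup₂_le fun q hq => (h.measure_Ici_le_liminf (hpos hq)).trans ?_
    refine liminf_le_liminf (.of_forall fun a => ?_)
    gcongr
    exact fun x hx => hU hx hq

/-- The layer-cake formula writes both integrals through the superlevel sets of `Ψ`, which are upper
sets; those of positive level lie in `(0, ∞)` because `Ψ` vanishes elsewhere. Fatou's lemma then
brings the lower limit outside. -/
lemma lintegral_monotone_le_liminf (h : IsSubordinatorLaw m β ν) {Ψ : ℝ → ℝ} (hΨ : Monotone Ψ)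
    (h0 : ∀ z ≤ 0, Ψ z = 0) :
    ∫⁻ z, ENNReal.ofReal (Ψ z) ∂ν ≤
      liminf (fun a : ℝ≥0 => (a : ℝ≥0∞)⁻¹ * ∫⁻ z, ENNReal.ofReal (Ψ z) ∂(m a)) (𝓝[>] 0) := by
  have hnn : ∀ z, 0 ≤ Ψ z := fun z => by
    rcases le_total z 0 with hz | hz
    · exact (h0 z hz).ge
    · exact (h0 0 le_rfl).ge.trans (hΨ hz)
  have hcake : ∀ κ : Measure ℝ, ∫⁻ z, ENNReal.ofReal (Ψ z) ∂κ
      = ∫⁻ t in Ioi 0, κ {z | t < Ψ z} := fun κ =>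
    lintegral_eq_lintegral_meas_lt κ (.of_forall hnn) hΨ.measurable.aemeasurable
  have hmeas : ∀ a, Measurable fun t : ℝ => m a {z | t < Ψ z} := fun a =>
    Antitone.measurable fun s t hst => measure_mono fun z (hz : t < Ψ z) => hst.trans_lt hz
  simp_rw [hcake]
  calc ∫⁻ t in Ioi 0, ν {z | t < Ψ z}
      ≤ ∫⁻ t in Ioi 0, liminf (fun a : ℝ≥0 => (a : ℝ≥0∞)⁻¹ * m a {z | t < Ψ z}) (𝓝[>] 0) := by
        refine setLIntegral_mono_ae' measurableSet_Ioi (.of_forall fun t ht => ?_)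
        refine h.measure_isUpperSet_le_liminf (fun x y hxy hx => hx.trans_le (hΨ hxy)) ?_
        intro z hz
        by_contra hz0
        have : t < Ψ z := hz
        rw [h0 z (not_lt.1 hz0)] at this
        exact lt_asymm this ht
    _ ≤ liminf (fun a : ℝ≥0 => ∫⁻ t in Ioi 0, (a : ℝ≥0∞)⁻¹ * m a {z | t < Ψ z}) (𝓝[>] 0) :=
        lintegral_liminf_le fun a => (hmeas a).const_mul _
    _ = _ := by simp_rw [lintegral_const_mul _ (hmeas _)]

lemma eventually_integral_monotone_ge (h : IsSubordinatorLaw m β ν) {Φ : ℝ → ℝ} (hΦ : Monotone Φ)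
    {C : ℝ} (hC : ∀ z, |Φ z| ≤ C) {ε : ℝ} (hε : 0 < ε) :
    ∀ᶠ a in 𝓝[>] 0, ∫ z, Φ z ∂canonicalMeasure β ν - ε ≤ ∫ z, Φ z ∂scaledLaw m a := by
  have hK := h.levyMeasure.isFiniteMeasure_canonicalMeasure (β := β)
  have hKa := h.isFiniteMeasure_scaledLaw
  -- Subtracting `Φ 0` leaves a term controlled by convergence of the total masses, and removes the
  -- contribution of the atom at `0`. The density `1 - e^{-z}` is absorbed into `Ψ`, which remains
  -- monotone as a product of nonnegative monotone functions.
  set Ψ : ℝ → ℝ := fun z => max 0 (Φ z - Φ 0) * max 0 (1 - Real.exp (-z)) with hΨdef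
  have hexpmono : Monotone fun z : ℝ => max 0 (1 - Real.exp (-z)) := fun x y hxy =>
    max_le_max_left 0 (by have := Real.exp_le_exp.2 (neg_le_neg hxy); linarith)
  have hΨ : Monotone Ψ := fun x y hxy =>
    mul_le_mul (max_le_max_left 0 (by linarith [hΦ hxy])) (hexpmono hxy) (le_max_left _ _)
      (le_max_left _ _)
  have hΨ0 : ∀ z ≤ 0, Ψ z = 0 := fun z hz => by
    simp only [hΨdef]
    rw [max_eq_left (by linarith [hΦ hz]), zero_mul]
  have hΨnn : ∀ z, 0 ≤ Ψ z := fun z => mul_nonneg (le_max_left _ _) (le_max_left _ _)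
  have hΨeq : ∀ z, 0 ≤ z → Ψ z = (1 - Real.exp (-z)) * (Φ z - Φ 0) := fun z hz => by
    have := one_sub_exp_nonneg zero_le_one hz
    rw [one_mul] at this
    simp only [hΨdef]
    rw [max_eq_right (by linarith [hΦ hz]), max_eq_right this, mul_comm]
  have hint : ∀ (κ : Measure ℝ) [IsFiniteMeasure κ], Integrable (fun z => Φ z - Φ 0) κ :=
    fun κ _ => (integrable_of_bounded hΦ.measurable hC).sub (integrable_const _)
  have hsplit : ∀ (κ : Measure ℝ) [IsFiniteMeasure κ],
      ∫ z, Φ z ∂κ = Φ 0 * κ.real univ + ∫ z, (Φ z - Φ 0) ∂κ := fun κ _ => by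
    rw [integral_sub (integrable_of_bounded hΦ.measurable hC) (integrable_const _)]
    simp [mul_comm]
  have hmass : Tendsto (fun a => Φ 0 * (scaledLaw m a).real univ) (𝓝[>] 0)
      (𝓝 (Φ 0 * (canonicalMeasure β ν).real univ)) := by
    simpa using (h.tendsto_integral_pow 0).const_mul (Φ 0)
  have hA : ∫ z, (Φ z - Φ 0) ∂canonicalMeasure β ν = ∫ z in Ioi 0, Ψ z ∂ν := by
    rw [IsSubordinatorLevyMeasure.integral_canonicalMeasure h.drift_nonneg (hint _), sub_self,
      mul_zero, zero_add]
    exact setIntegral_congr_fun measurableSet_Ioi fun z hz => (hΨeq z (le_of_lt hz)).symm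
  have hAint : IntegrableOn Ψ (Ioi 0) ν :=
    (IsSubordinatorLevyMeasure.integrable_canonicalMeasure_iff
      (hint (canonicalMeasure β ν))).congr_fun
      (fun z hz => (hΨeq z (le_of_lt hz)).symm) measurableSet_Ioi
  have hB : ∀ a, ∫ z, (Φ z - Φ 0) ∂scaledLaw m a = (∫ z, Ψ z ∂(m a)) / a := fun a => by
    rw [h.integral_scaledLaw]
    congr 1
    refine integral_congr_ae ?_
    filter_upwards [h.nonneg a] with z hz using (hΨeq z hz).symm
  have hev : ∀ᶠ a in 𝓝[>] 0,
      ∫ z, (Φ z - Φ 0) ∂canonicalMeasure β ν - ε / 2 ≤ ∫ z, (Φ z - Φ 0) ∂scaledLaw m a := by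
    rw [hA]
    set A := ∫ z in Ioi 0, Ψ z ∂ν
    rcases le_or_gt (A - ε / 2) 0 with hA0 | hA0
    · refine .of_forall fun a => hA0.trans ?_
      rw [hB]
      exact div_nonneg (integral_nonneg hΨnn) a.coe_nonneg
    have h1 : ENNReal.ofReal (A - ε / 2) <
        liminf (fun a : ℝ≥0 => (a : ℝ≥0∞)⁻¹ * ∫⁻ z, ENNReal.ofReal (Ψ z) ∂(m a)) (𝓝[>] 0) := by
      refine lt_of_lt_of_le ?_ (h.lintegral_monotone_le_liminf hΨ hΨ0)
      refine lt_of_lt_of_le ?_ (lintegral_mono' Measure.restrict_le_self le_rfl :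
        ∫⁻ z in Ioi 0, ENNReal.ofReal (Ψ z) ∂ν ≤ _)
      rw [← ofReal_integral_eq_lintegral_ofReal hAint (.of_forall hΨnn)]
      exact (ENNReal.ofReal_lt_ofReal_iff (by linarith)).2 (by linarith)
    filter_upwards [eventually_lt_of_lt_liminf h1, self_mem_nhdsWithin] with a ha ha0
    have := h.isProbability a
    have ha0' : (0 : ℝ) < a := by exact_mod_cast ha0
    have hΨint : Integrable Ψ (m a) := by
      refine (integrable_const (2 * C)).mono' hΨ.measurable.aestronglyMeasurable ?_
      filter_upwards [h.nonneg a] with z hz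
      rw [Real.norm_of_nonneg (hΨnn z), hΨeq z hz]
      have h1 := abs_le.1 (hC z)
      have h2 := abs_le.1 (hC 0)
      have h3 := hΦ hz
      have h4 := Real.exp_pos (-z)
      have h5 := one_sub_exp_nonneg zero_le_one hz
      rw [one_mul] at h5
      nlinarith
    rw [← ofReal_integral_eq_lintegral_ofReal hΨint (.of_forall hΨnn),
      ← ENNReal.ofReal_coe_nnreal, ← ENNReal.ofReal_inv_of_pos ha0',
      ← ENNReal.ofReal_mul (by positivity)] at ha
    rw [hB, ← inv_mul_eq_div (a : ℝ)]
    exact ((ENNReal.ofReal_lt_ofReal_iff_of_nonneg hA0.le).1 ha).le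
  filter_upwards [hev, hmass.eventually_const_lt
    (show Φ 0 * (canonicalMeasure β ν).real univ - ε / 2 < _ by linarith)] with a h1 h2
  rw [hsplit, hsplit (scaledLaw m a)]
  linarith

/-- The generator at `0` of a subordinator, on bounded right-continuous functions that have a
right derivative at `0`. -/
theorem tendsto_integral_sub_div (h : IsSubordinatorLaw m β ν) {G : ℝ → ℝ} (hG : Measurable G)
    {C : ℝ} (hC : ∀ z, |G z| ≤ C) (hr : ∀ z, 0 ≤ z → ContinuousWithinAt G (Ici z) z) {D : ℝ}
    (hD : Tendsto (fun z => (G z - G 0) / z) (𝓝[>] 0) (𝓝 D)) :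
    IntegrableOn (fun z => G z - G 0) (Ioi 0) ν ∧
      Tendsto (fun a : ℝ≥0 => (∫ z, (G z - G 0) ∂(m a)) / a) (𝓝[>] 0)
        (𝓝 (β * D + ∫ z in Ioi 0, (G z - G 0) ∂ν)) := by
  have hK := h.levyMeasure.isFiniteMeasure_canonicalMeasure (β := β)
  have hKa := h.isFiniteMeasure_scaledLaw
  -- As `1 - e^{-z} ~ z` at `0`, the value `D` makes `ψ` right-continuous there; against the atom of
  -- mass `β` this value produces the drift term `β D`.
  set ψ : ℝ → ℝ := fun z => if z ≤ 0 then D else (G z - G 0) / (1 - Real.exp (-z)) with hψdef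
  have hpos : ∀ z : ℝ, 0 < z → 0 < 1 - Real.exp (-z) := fun z hz => by
    rw [sub_pos, ← Real.exp_zero]; exact Real.exp_lt_exp.2 (by linarith)
  have hψmeas : Measurable ψ := Measurable.ite measurableSet_Iic measurable_const (by fun_prop)
  have hψ0 : ψ 0 = D := by simp [hψdef]
  have hψpos : ∀ z, 0 < z → ψ z = (G z - G 0) / (1 - Real.exp (-z)) := fun z hz => by
    simp [hψdef, not_le.2 hz]
  have hψlim : Tendsto ψ (𝓝[>] 0) (𝓝 D) := by
    have h1 : Tendsto (fun z : ℝ => (1 - Real.exp (-z)) / z) (𝓝[>] 0) (𝓝 1) := by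
      have hd : HasDerivAt (fun z : ℝ => -Real.exp (-z)) 1 0 := by
        simpa using ((hasDerivAt_id' (0 : ℝ)).fun_neg.exp).fun_neg
      refine hd.tendsto_slope_zero_right.congr fun z => ?_
      simp only [zero_add, neg_zero, Real.exp_zero, smul_eq_mul]
      ring
    have h2 := hD.div h1 one_ne_zero
    rw [div_one] at h2
    refine h2.congr' ?_
    filter_upwards [self_mem_nhdsWithin] with z hz
    have := (hpos z hz).ne'
    have : z ≠ 0 := ne_of_gt hz
    rw [hψpos z hz]
    simp only [Pi.div_apply]
    field_simp
  have hψr : ∀ z, 0 ≤ z → ContinuousWithinAt ψ (Ici z) z := by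
    intro z hz
    rcases hz.eq_or_lt with rfl | hz
    · rw [← continuousWithinAt_Ioi_iff_Ici, ContinuousWithinAt, hψ0]
      exact hψlim
    · have h1 : ContinuousWithinAt (fun z => (G z - G 0) / (1 - Real.exp (-z))) (Ici z) z :=
        ((hr z hz.le).sub continuousWithinAt_const).div (by fun_prop) (hpos z hz).ne'
      exact h1.congr (fun w hw => hψpos w (hz.trans_le hw)) (hψpos z hz)
  obtain ⟨M, hM⟩ : ∃ M, ∀ z, |ψ z| ≤ M := by
    have h1 : ∀ᶠ z in 𝓝[>] 0, |ψ z| < |D| + 1 :=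
      hψlim.abs.eventually_lt_const (by linarith)
    obtain ⟨η, hη, hη1⟩ := mem_nhdsGT_iff_exists_Ioo_subset.1 h1
    -- The first bound holds near `0`, where `ψ` is close to `D`; beyond `η` the denominator is at
    -- least `1 - e^{-η}`.
    refine ⟨max (|D| + 1) (2 * C / (1 - Real.exp (-η))), fun z => ?_⟩
    rcases le_or_gt z 0 with hz | hz
    · have : ψ z = D := by simp [hψdef, hz]
      rw [this]
      exact le_max_of_le_left (by linarith)
    rcases lt_or_ge z η with hzη | hzη
    · exact le_max_of_le_left (le_of_lt (hη1 ⟨hz, hzη⟩))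
    · refine le_max_of_le_right ?_
      rw [hψpos z hz, abs_div, abs_of_pos (hpos z hz)]
      have h2 : |G z - G 0| ≤ 2 * C := by
        have := abs_sub (G z) (G 0)
        linarith [hC z, hC 0]
      refine div_le_div₀ ((abs_nonneg _).trans h2) h2 (hpos η hη) ?_
      have := Real.exp_le_exp.2 (neg_le_neg hzη)
      linarith
  have hψint : Integrable ψ (canonicalMeasure β ν) := integrable_of_bounded hψmeas hM
  have hψG : ∀ z, 0 ≤ z → (1 - Real.exp (-z)) * ψ z = G z - G 0 := fun z hz => by
    rcases hz.eq_or_lt with rfl | hz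
    · simp
    · rw [hψpos z hz, mul_div_cancel₀ _ (hpos z hz).ne']
  refine ⟨(IsSubordinatorLevyMeasure.integrable_canonicalMeasure_iff hψint).congr_fun
    (fun z hz => hψG z (le_of_lt hz)) measurableSet_Ioi, ?_⟩
  have hlim := tendsto_integral_of_monotone (l := 𝓝[>] 0) (κi := scaledLaw m)
    (κ := canonicalMeasure β ν)
    IsSubordinatorLevyMeasure.canonicalMeasure_nonneg
    (fun Φ hΦ C hC ε hε => h.eventually_integral_monotone_ge hΦ hC hε)
    (by simpa using h.tendsto_integral_pow 1) hψmeas hM hψr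
  rw [IsSubordinatorLevyMeasure.integral_canonicalMeasure h.drift_nonneg hψint, hψ0,
    setIntegral_congr_fun measurableSet_Ioi fun z hz => hψG z (le_of_lt hz)] at hlim
  refine hlim.congr fun a => ?_
  rw [h.integral_scaledLaw]
  congr 1
  refine integral_congr_ae ?_
  filter_upwards [h.nonneg a] with z hz using hψG z hz

end IsSubordinatorLaw

/-! ### Flows of laws increasing for the convex order -/

/-- A family of probability measures started from the Dirac mass at `x`, weakly right-continuous,
increasing for the convex order, with finite moments of order `q ≥ 1`. -/
structure IsConvexFlow (Q : ℝ → Measure ℝ) (x q : ℝ) : Prop where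
  isProbability : ∀ z, 0 ≤ z → IsProbabilityMeasure (Q z)
  zero : Q 0 = Measure.dirac x
  rightContinuous : ∀ z, 0 ≤ z → ∀ g : BoundedContinuousFunction ℝ ℝ,
    Tendsto (fun w => ∫ y, g y ∂(Q w)) (𝓝[>] z) (𝓝 (∫ y, g y ∂(Q z)))
  lintegral_mono : ∀ z w, 0 ≤ z → z ≤ w → ∀ φ : ℝ → ℝ, ConvexOn ℝ univ φ → Continuous φ →
    (∀ y, 0 ≤ φ y) → ∫⁻ y, ENNReal.ofReal (φ y) ∂(Q z) ≤ ∫⁻ y, ENNReal.ofReal (φ y) ∂(Q w)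
  one_le : 1 ≤ q
  lintegral_lt_top : ∀ z, 0 ≤ z → ∫⁻ y, ENNReal.ofReal (|y| ^ q) ∂(Q z) < ∞

lemma convexOn_abs_rpow {q : ℝ} (hq : 1 ≤ q) : ConvexOn ℝ univ fun y : ℝ => |y| ^ q := by
  have h1 : ConvexOn ℝ univ fun y : ℝ => |y| := convexOn_norm convex_univ
  have h2 : (fun y : ℝ => |y|) '' univ = Ici 0 := by
    ext y
    simp only [image_univ, mem_range, mem_Ici]
    exact ⟨by rintro ⟨w, rfl⟩; exact abs_nonneg w, fun hy => ⟨y, abs_of_nonneg hy⟩⟩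
  refine ConvexOn.comp (g := fun r : ℝ => r ^ q) (f := fun y : ℝ => |y|) ?_ h1 ?_
  · rw [h2]; exact convexOn_rpow hq
  · rw [h2]; exact fun r hr s _ hrs => Real.rpow_le_rpow hr hrs (by linarith)

lemma continuous_abs_rpow {q : ℝ} (hq : 0 ≤ q) : Continuous fun y : ℝ => |y| ^ q :=
  continuous_abs.rpow_const fun _ => Or.inr hq

namespace IsConvexFlow

variable {Q : ℝ → Measure ℝ} {x q : ℝ}

lemma nonneg (h : IsConvexFlow Q x q) : 0 ≤ q := zero_le_one.trans h.one_le

lemma integrable_abs_rpow (h : IsConvexFlow Q x q) {z : ℝ} (hz : 0 ≤ z) :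
    Integrable (fun y => |y| ^ q) (Q z) := by
  refine ⟨(continuous_abs_rpow h.nonneg).aestronglyMeasurable, ?_⟩
  rw [hasFiniteIntegral_iff_ofReal (.of_forall fun y => by positivity)]
  exact h.lintegral_lt_top z hz

lemma integrable_of_growth (h : IsConvexFlow Q x q) {z : ℝ} (hz : 0 ≤ z) {g : ℝ → ℝ}
    (hg : Measurable g) {C : ℝ} (hC : ∀ y, |g y| ≤ C * (1 + |y| ^ q)) : Integrable g (Q z) := by
  have := h.isProbability z hz
  exact (((integrable_const _).add (h.integrable_abs_rpow hz)).const_mul C).mono'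
    hg.aestronglyMeasurable (.of_forall hC)

lemma integral_le_of_convexOn (h : IsConvexFlow Q x q) {z w : ℝ} (hz : 0 ≤ z) (hzw : z ≤ w)
    {φ : ℝ → ℝ} (hφ : ConvexOn ℝ univ φ) (hc : Continuous φ) (h0 : ∀ y, 0 ≤ φ y)
    (hi : Integrable φ (Q w)) : ∫ y, φ y ∂(Q z) ≤ ∫ y, φ y ∂(Q w) := by
  rw [integral_eq_lintegral_of_nonneg_ae (.of_forall h0) hc.aestronglyMeasurable,
    integral_eq_lintegral_of_nonneg_ae (.of_forall h0) hc.aestronglyMeasurable]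
  refine ENNReal.toReal_mono ?_ (h.lintegral_mono z w hz hzw φ hφ hc h0)
  exact ((hasFiniteIntegral_iff_ofReal (.of_forall h0)).1 hi.2).ne

/-- Moments are bounded on compact time intervals. -/
lemma integral_growth_le (h : IsConvexFlow Q x q) {z w : ℝ} (hz : 0 ≤ z) (hzw : z ≤ w) :
    ∫ y, (1 + |y| ^ q) ∂(Q z) ≤ ∫ y, (1 + |y| ^ q) ∂(Q w) := by
  have := h.isProbability w (hz.trans hzw)
  refine h.integral_le_of_convexOn hz hzw ?_ ?_ (fun y => by positivity)
    ((integrable_const _).add (h.integrable_abs_rpow (hz.trans hzw)))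
  · exact (convexOn_const 1 convex_univ).add (convexOn_abs_rpow h.one_le)
  · exact continuous_const.add (continuous_abs_rpow h.nonneg)

/-- Uniform integrability of the `q`-th powers on compact time intervals. -/
lemma exists_integral_excess_le (h : IsConvexFlow Q x q) {w : ℝ} (hw : 0 ≤ w) {ε : ℝ}
    (hε : 0 < ε) :
    ∃ K : ℝ, 0 ≤ K ∧ ∀ z, 0 ≤ z → z ≤ w → ∫ y, max (|y| ^ q - K) 0 ∂(Q z) ≤ ε := by
  have hcont : ∀ K : ℝ, Continuous fun y : ℝ => max (|y| ^ q - K) 0 := fun K =>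
    ((continuous_abs_rpow h.nonneg).sub continuous_const).max continuous_const
  have hbound : ∀ (n : ℕ) (y : ℝ), max (|y| ^ q - n) 0 ≤ |y| ^ q := fun n y => by
    have h1 : 0 ≤ |y| ^ q := by positivity
    have h2 : (0 : ℝ) ≤ n := n.cast_nonneg
    exact max_le (by linarith) h1
  have hint : ∀ n : ℕ, Integrable (fun y : ℝ => max (|y| ^ q - n) 0) (Q w) := fun n =>
    (h.integrable_abs_rpow hw).mono' (hcont n).aestronglyMeasurable (.of_forall fun y => by
      rw [Real.norm_of_nonneg (le_max_right _ _)]; exact hbound n y)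
  have hlim : Tendsto (fun n : ℕ => ∫ y : ℝ, max (|y| ^ q - n) 0 ∂(Q w)) atTop (𝓝 0) := by
    have := tendsto_integral_of_dominated_convergence (μ := Q w)
      (F := fun (n : ℕ) y => max (|y| ^ q - n) 0) (f := fun _ => 0) (fun y => |y| ^ q)
      (fun n => (hcont n).aestronglyMeasurable) (h.integrable_abs_rpow hw)
      (fun n => .of_forall fun y => by
        rw [Real.norm_of_nonneg (le_max_right _ _)]; exact hbound n y)
      (.of_forall fun y => by
        obtain ⟨N, hN⟩ := exists_nat_ge (|y| ^ q)
        refine tendsto_const_nhds.congr' ?_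
        filter_upwards [eventually_ge_atTop N] with n hn
        have : (N : ℝ) ≤ n := by exact_mod_cast hn
        exact (max_eq_right (by linarith)).symm)
    simpa using this
  obtain ⟨n, hn⟩ := (hlim.eventually_lt_const hε).exists
  -- The excess `(|y|^q - n)⁺` is convex, so its integral at any earlier time is at most the one at
  -- time `w`; a single truncation level serves the whole interval.
  refine ⟨n, n.cast_nonneg, fun z hz hzw => (h.integral_le_of_convexOn hz hzw ?_ (hcont n)
    (fun y => le_max_right _ _) (hint n)).trans hn.le⟩
  exact ((convexOn_abs_rpow h.one_le).sub (concaveOn_const (n : ℝ) convex_univ)).sup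
    (convexOn_const 0 convex_univ)

/-- Right-continuity of the integrals of continuous functions of growth `q`. -/
lemma continuousWithinAt_integral (h : IsConvexFlow Q x q) {z : ℝ} (hz : 0 ≤ z) {g : ℝ → ℝ}
    (hg : Continuous g) {C : ℝ} (hC : ∀ y, |g y| ≤ C * (1 + |y| ^ q)) :
    ContinuousWithinAt (fun w => ∫ y, g y ∂(Q w)) (Ici z) z := by
  rw [← continuousWithinAt_Ioi_iff_Ici, ContinuousWithinAt, Metric.tendsto_nhds]
  intro ε hε
  have hC0 : 0 ≤ C := by
    have h1 := (abs_nonneg _).trans (hC 0)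
    have h2 : (0 : ℝ) ≤ |(0 : ℝ)| ^ q := by positivity
    by_contra hneg
    nlinarith
  obtain ⟨K, hK, hKε⟩ := h.exists_integral_excess_le (show 0 ≤ z + 1 by linarith)
    (show 0 < ε / (4 * (C + 1)) by positivity)
  -- The value of the growth bound where `|y|^q = K`: truncating `g` at `±B` changes it by at most
  -- `C (|y|^q - K)⁺`.
  set B := C * (1 + K) with hB
  have hB0 : 0 ≤ B := by positivity
  let c : BoundedContinuousFunction ℝ ℝ := BoundedContinuousFunction.ofNormedAddCommGroup
    (fun y => max (-B) (min B (g y))) (by fun_prop) B fun y => by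
      rw [Real.norm_eq_abs, abs_le]
      exact ⟨le_max_left _ _, max_le (by linarith) (min_le_left _ _)⟩
  have hc : ∀ y, c y = max (-B) (min B (g y)) := fun y => rfl
  have hdiff : ∀ y, |g y - c y| ≤ C * max (|y| ^ q - K) 0 := by
    intro y
    have h1 := abs_le.1 (hC y)
    have h2 : C * (|y| ^ q - K) ≤ C * max (|y| ^ q - K) 0 :=
      mul_le_mul_of_nonneg_left (le_max_left _ _) hC0
    have h3 : 0 ≤ C * max (|y| ^ q - K) 0 := mul_nonneg hC0 (le_max_right _ _)
    have h4 : C * (1 + |y| ^ q) = B + C * (|y| ^ q - K) := by rw [hB]; ring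
    rw [hc, abs_le]
    rcases le_total B (g y) with h5 | h5
    · rw [min_eq_left h5, max_eq_right (show -B ≤ B by linarith)]
      constructor <;> linarith
    · rw [min_eq_right h5]
      rcases le_total (-B) (g y) with h6 | h6
      · rw [max_eq_right h6]; constructor <;> linarith
      · rw [max_eq_left h6]; constructor <;> linarith
  have hclose : ∀ w, 0 ≤ w → w ≤ z + 1 → |∫ y, g y ∂(Q w) - ∫ y, c y ∂(Q w)| ≤ ε / 4 := by
    intro w hw hwz
    have := h.isProbability w hw
    rw [← integral_sub (h.integrable_of_growth hw hg.measurable hC) (c.integrable _)]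
    refine (abs_integral_le_integral_abs).trans ?_
    have hi : Integrable (fun y => max (|y| ^ q - K) 0) (Q w) :=
      ((h.integrable_abs_rpow hw).sub (integrable_const K)).pos_part
    refine (integral_mono_of_nonneg (.of_forall fun y => abs_nonneg _) (hi.const_mul C)
      (.of_forall hdiff)).trans ?_
    rw [integral_const_mul]
    calc C * ∫ y, max (|y| ^ q - K) 0 ∂(Q w) ≤ (C + 1) * (ε / (4 * (C + 1))) := by
          gcongr
          · linarith
          · exact hKε w hw hwz
      _ = ε / 4 := by field_simp
  filter_upwards [Metric.tendsto_nhds.1 (h.rightContinuous z hz c) (ε / 4) (by positivity),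
    Ioo_mem_nhdsGT (show z < z + 1 by linarith)] with w h1 hw
  have h2 := abs_le.1 (hclose z hz (by linarith))
  have h3 := abs_le.1 (hclose w (hz.trans hw.1.le) hw.2.le)
  rw [Real.dist_eq, abs_lt] at h1 ⊢
  constructor <;> linarith [h1.1, h1.2]

/-- Integrals of functions converging near the starting point. -/
lemma tendsto_integral_of_tendsto_prod (h : IsConvexFlow Q x q) {ι : Type*} {l : Filter ι}
    {zi : ι → ℝ} (hzi : Tendsto zi l (𝓝[≥] 0)) {k : ι → ℝ → ℝ} (hk : ∀ i, Measurable (k i))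
    {C : ℝ} (hC : ∀ᶠ i in l, ∀ y, |k i y| ≤ C * (1 + |y| ^ q)) {c : ℝ}
    (hlim : Tendsto (fun p : ι × ℝ => k p.1 p.2) (l ×ˢ 𝓝 x) (𝓝 c)) :
    Tendsto (fun i => ∫ y, k i y ∂(Q (zi i))) l (𝓝 c) := by
  rw [Metric.tendsto_nhds]
  intro ε hε
  obtain ⟨s, hs, u, hu, hsu⟩ := mem_prod_iff.1 (Metric.tendsto_nhds.1 hlim (ε / 3) (by positivity))
  obtain ⟨η, hη, hball⟩ := Metric.mem_nhds_iff.1 hu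
  set D := |C| + |c| with hD
  -- A continuous majorant of `|k i y - c|` outside the ball of radius `η` around `x`. It has growth
  -- `q` and vanishes at `x`, so its integrals tend to `b x = 0`.
  set b : ℝ → ℝ := fun y => D * (1 + |y| ^ q) * min 1 (|y - x| / η) with hb
  have hbc : Continuous b := by
    have := continuous_abs_rpow h.nonneg
    simp only [hb]; fun_prop
  have hb0 : ∀ y, 0 ≤ b y := fun y => by
    have : 0 ≤ min 1 (|y - x| / η) := le_min zero_le_one (by positivity)
    simp only [hb]; positivity
  have hbg : ∀ y, |b y| ≤ D * (1 + |y| ^ q) := fun y => by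
    rw [abs_of_nonneg (hb0 y)]
    exact mul_le_of_le_one_right (by positivity) (min_le_left _ _)
  have hbx : ∫ y, b y ∂(Q 0) = 0 := by rw [h.zero, integral_dirac]; simp [hb]
  have hblim : Tendsto (fun i => ∫ y, b y ∂(Q (zi i))) l (𝓝 0) := by
    have := (h.continuousWithinAt_integral le_rfl hbc hbg).tendsto.comp hzi
    rwa [hbx] at this
  filter_upwards [hs, hC, hblim.eventually_lt_const (show 0 < ε / 3 by positivity),
    hzi self_mem_nhdsWithin] with i his hiC hib hiz
  have hz0 : 0 ≤ zi i := hiz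
  have := h.isProbability _ hz0
  have hki : Integrable (k i) (Q (zi i)) := h.integrable_of_growth hz0 (hk i) hiC
  have hptw : ∀ y, |k i y - c| ≤ ε / 3 + b y := by
    intro y
    rcases lt_or_ge (dist y x) η with hy | hy
    · have h1 : dist (k i y) c < ε / 3 := hsu (mk_mem_prod his (hball hy))
      rw [Real.dist_eq] at h1
      linarith [hb0 y]
    · have h1 : min 1 (|y - x| / η) = 1 :=
        min_eq_left ((one_le_div hη).2 (by rwa [Real.dist_eq] at hy))
      have h2 : |k i y - c| ≤ |k i y| + |c| := abs_sub _ _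
      have h3 : 0 ≤ |y| ^ q := by positivity
      have h4 : C * (1 + |y| ^ q) ≤ |C| * (1 + |y| ^ q) := by
        gcongr; exact le_abs_self C
      have h5 : |c| ≤ |c| * (1 + |y| ^ q) := le_mul_of_one_le_right (abs_nonneg _) (by linarith)
      have h6 := hiC y
      simp only [hb, h1, hD]
      nlinarith
  have h1 : ∫ y, k i y ∂(Q (zi i)) - c = ∫ y, (k i y - c) ∂(Q (zi i)) := by
    rw [integral_sub hki (integrable_const _)]; simp
  rw [Real.dist_eq, h1]
  calc |∫ y, (k i y - c) ∂(Q (zi i))| ≤ ∫ y, |k i y - c| ∂(Q (zi i)) :=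
        abs_integral_le_integral_abs
    _ ≤ ∫ y, (ε / 3 + b y) ∂(Q (zi i)) :=
        integral_mono_of_nonneg (.of_forall fun y => abs_nonneg _)
          ((integrable_const _).add (h.integrable_of_growth hz0 hbc.measurable hbg))
          (.of_forall hptw)
    _ = ε / 3 + ∫ y, b y ∂(Q (zi i)) := by
        rw [integral_add (integrable_const _) (h.integrable_of_growth hz0 hbc.measurable hbg)]
        simp
    _ < ε := by linarith

/-- Differentiation of the integrals of dilated functions at the starting point. -/
lemma tendsto_integral_dilation (h : IsConvexFlow Q x q) {ι : Type*} {l : Filter ι}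
    {zi : ι → ℝ} (hzi : Tendsto zi l (𝓝[≥] 0)) {f : ℝ → ℝ} (hf : ContDiff ℝ 1 f) {C : ℝ}
    (hC : ∀ α γ y : ℝ, 0 ≤ α → α ≤ 2 → 0 ≤ γ → γ ≤ 2 →
      |f (α * y) - f (γ * y)| ≤ |α - γ| * (C * (1 + |y| ^ q)))
    {α γ r : ι → ℝ} (hα : Tendsto α l (𝓝 1)) (hγ : Tendsto γ l (𝓝 1)) {d : ℝ}
    (hd : Tendsto (fun i => (α i - γ i) / r i) l (𝓝 d)) :
    Tendsto (fun i => ∫ y, (f (α i * y) - f (γ i * y)) / r i ∂(Q (zi i))) l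
      (𝓝 (d * x * deriv f x)) := by
  have hfc := hf.continuous
  refine h.tendsto_integral_of_tendsto_prod hzi (C := (|d| + 1) * |C|) (fun i => by fun_prop) ?_ ?_
  · filter_upwards [hα.eventually (Icc_mem_nhds zero_lt_one one_lt_two),
      hγ.eventually (Icc_mem_nhds zero_lt_one one_lt_two),
      hd.abs.eventually_lt_const (show |d| < |d| + 1 by linarith)] with i h1 h2 h3 y
    rw [abs_div]
    have h4 := hC (α i) (γ i) y h1.1 h1.2 h2.1 h2.2
    rw [abs_div] at h3
    calc |f (α i * y) - f (γ i * y)| / |r i| ≤ |α i - γ i| * (C * (1 + |y| ^ q)) / |r i| := by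
          gcongr
      _ = |α i - γ i| / |r i| * (C * (1 + |y| ^ q)) := by ring
      _ ≤ |α i - γ i| / |r i| * (|C| * (1 + |y| ^ q)) := by gcongr; exact le_abs_self C
      _ ≤ (|d| + 1) * (|C| * (1 + |y| ^ q)) := by gcongr
      _ = _ := by ring
  -- Both arguments `α y` and `γ y` move as `y → x`, so an ordinary derivative at `x` would not
  -- control the increment; a `C¹` function is strictly differentiable.
  · have hs : HasStrictDerivAt f (deriv f x) x :=
      hf.contDiffAt.hasStrictDerivAt one_ne_zero
    have hp1 : Tendsto (fun p : ι × ℝ => p.2) (l ×ˢ 𝓝 x) (𝓝 x) := tendsto_snd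
    have hα' : Tendsto (fun p : ι × ℝ => α p.1 * p.2) (l ×ˢ 𝓝 x) (𝓝 x) := by
      simpa using (hα.comp tendsto_fst).mul hp1
    have hγ' : Tendsto (fun p : ι × ℝ => γ p.1 * p.2) (l ×ˢ 𝓝 x) (𝓝 x) := by
      simpa using (hγ.comp tendsto_fst).mul hp1
    have ho := hs.hasStrictFDerivAt.isLittleO.comp_tendsto (hα'.prodMk_nhds hγ')
    have hd' : Tendsto (fun p : ι × ℝ => (α p.1 - γ p.1) / r p.1 * p.2) (l ×ˢ 𝓝 x) (𝓝 (d * x)) :=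
      (hd.comp tendsto_fst).mul hp1
    have hsmall : Tendsto (fun p : ι × ℝ => (f (α p.1 * p.2) - f (γ p.1 * p.2)
        - (α p.1 * p.2 - γ p.1 * p.2) * deriv f x) / r p.1) (l ×ˢ 𝓝 x) (𝓝 0) := by
      have hO : (fun p : ι × ℝ => (f (α p.1 * p.2) - f (γ p.1 * p.2)
          - (α p.1 * p.2 - γ p.1 * p.2) * deriv f x) / r p.1) =o[l ×ˢ 𝓝 x]
          fun p : ι × ℝ => (α p.1 - γ p.1) / r p.1 * p.2 := by
        have := ho.mul_isBigO (Asymptotics.isBigO_refl (fun p : ι × ℝ => (r p.1)⁻¹) (l ×ˢ 𝓝 x))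
        refine this.congr (fun p => ?_) (fun p => ?_)
        · simp [div_eq_mul_inv, mul_comm]
        · simp only [Function.comp_apply]; ring
      exact (Asymptotics.isLittleO_one_iff ℝ).1 (hO.trans_isBigO (hd'.isBigO_one ℝ))
    have := hsmall.add (hd'.mul_const (deriv f x))
    rw [zero_add] at this
    refine this.congr fun p => ?_
    ring

end IsConvexFlow

/-! ### Dilation estimates and small-time averages -/

/-- Growth of a `C¹` function, and of its increments along dilations. -/
lemma IsC1OfGrowth.exists_dilation_bound {p : ℝ} (hp : 0 ≤ p) {f : ℝ → ℝ}
    (hf : IsC1OfGrowth p f) :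
    ∃ C : ℝ, 0 ≤ C ∧ (∀ y, |f y| ≤ C * (1 + |y| ^ p)) ∧ (∀ y, |f y| ≤ C * (1 + |y| ^ max p 1)) ∧
      ∀ α γ y : ℝ, 0 ≤ α → α ≤ 2 → 0 ≤ γ → γ ≤ 2 →
        |f (α * y) - f (γ * y)| ≤ |α - γ| * (C * (1 + |y| ^ max p 1)) := by
  obtain ⟨hf1, C, hC⟩ := hf
  have hC0 : 0 ≤ C := by
    have h1 := (abs_nonneg _).trans (hC 0).1
    have h2 : (0 : ℝ) ≤ |(0 : ℝ)| ^ p := by positivity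
    by_contra hneg
    nlinarith
  set q := max p 1 with hq
  set s := max (p - 1) 0 with hs
  have hs0 : 0 ≤ s := le_max_right _ _
  have hqs : q = 1 + s := by rw [hq, hs, ← max_add_add_left]; simp
  have hpow : ∀ y : ℝ, ∀ e : ℝ, 0 ≤ e → e ≤ q → |y| ^ e ≤ 1 + |y| ^ q := by
    intro y e he heq
    have h1 : 0 ≤ |y| ^ q := by positivity
    rcases le_total |y| 1 with hy | hy
    · have := Real.rpow_le_one (abs_nonneg y) hy he
      linarith
    · have := Real.rpow_le_rpow_of_exponent_le hy heq
      linarith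
  -- With `q = 1 + s`, the mean value theorem on `[-2|y|, 2|y|]` leads to `|y| (1 + (2|y|)^s) = |y|
  -- + 2^s |y|^q`, and `|y| ≤ 1 + |y|^q`.
  refine ⟨C * (2 + 2 ^ s), by positivity, fun y => (hC y).1.trans ?_, fun y => (hC y).1.trans ?_,
    ?_⟩
  · have h1 : (0 : ℝ) ≤ 2 ^ s := by positivity
    have h2 : 0 ≤ |y| ^ p := by positivity
    rw [mul_assoc]
    refine mul_le_mul_of_nonneg_left ?_ hC0
    nlinarith
  · have h1 : (0 : ℝ) ≤ 2 ^ s := by positivity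
    have h2 : 0 ≤ |y| ^ q := by positivity
    have h3 := hpow y p hp (le_max_left _ _)
    rw [mul_assoc]
    refine mul_le_mul_of_nonneg_left ?_ hC0
    nlinarith
  · intro α γ y hα hα2 hγ hγ2
    have hy0 := abs_nonneg y
    have hder : ∀ w ∈ Icc (-(2 * |y|)) (2 * |y|), ‖deriv f w‖ ≤ C * (1 + (2 * |y|) ^ s) := by
      intro w hw
      refine (hC w).2.trans (mul_le_mul_of_nonneg_left ?_ hC0)
      have : |w| ≤ 2 * |y| := abs_le.2 hw
      gcongr
    have hmem : ∀ θ : ℝ, 0 ≤ θ → θ ≤ 2 → θ * y ∈ Icc (-(2 * |y|)) (2 * |y|) := by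
      intro θ h0 h2
      rw [mem_Icc, ← abs_le, abs_mul, abs_of_nonneg h0]
      gcongr
    have hmv := (convex_Icc (-(2 * |y|)) (2 * |y|)).norm_image_sub_le_of_norm_deriv_le
      (fun w _ => hf1.differentiable one_ne_zero w) hder (hmem γ hγ hγ2) (hmem α hα hα2)
    rw [Real.norm_eq_abs, Real.norm_eq_abs, ← sub_mul, abs_mul] at hmv
    refine hmv.trans ?_
    have h1 : |y| * (1 + (2 * |y|) ^ s) ≤ (2 + 2 ^ s) * (1 + |y| ^ q) := by
      have h2 : |y| * |y| ^ s = |y| ^ q := by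
        rw [hqs, Real.rpow_add_of_nonneg hy0 zero_le_one hs0, Real.rpow_one]
      have h3 := hpow y 1 zero_le_one (le_max_right _ _)
      rw [Real.rpow_one] at h3
      rw [Real.mul_rpow zero_le_two hy0]
      have h4 : (0 : ℝ) ≤ 2 ^ s := by positivity
      have h5 : 0 ≤ |y| ^ q := by positivity
      have h6 : |y| * (1 + 2 ^ s * |y| ^ s) = |y| + 2 ^ s * |y| ^ q := by rw [← h2]; ring
      rw [h6]
      nlinarith
    calc C * (1 + (2 * |y|) ^ s) * (|α - γ| * |y|)
        = |α - γ| * (C * (|y| * (1 + (2 * |y|) ^ s))) := by ring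
      _ ≤ |α - γ| * (C * ((2 + 2 ^ s) * (1 + |y| ^ q))) := by gcongr
      _ = _ := by ring

/-- Averages of `D a z / a` over the law of a subordinator at the time `a ↓ 0`. -/
lemma IsSubordinatorLaw.tendsto_integral_div {m : ℝ≥0 → Measure ℝ} {β : ℝ} {ν : Measure ℝ}
    (h : IsSubordinatorLaw m β ν) {D : ℝ≥0 → ℝ → ℝ} (hD : ∀ a, Measurable (D a)) {c : ℝ}
    (hlim : Tendsto (fun p : ℝ≥0 × ℝ => D p.1 p.2 / p.1) (𝓝[>] 0 ×ˢ 𝓝[≥] 0) (𝓝 c))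
    (hloc : ∀ N : ℝ, ∃ B : ℝ, ∀ᶠ a : ℝ≥0 in 𝓝[>] 0, ∀ z, 0 ≤ z → z ≤ N → |D a z| ≤ B * a)
    {C : ℝ} (hC : ∀ᶠ a : ℝ≥0 in 𝓝[>] 0, ∀ z, 0 ≤ z → |D a z| ≤ C) :
    Tendsto (fun a : ℝ≥0 => (∫ z, D a z ∂(m a)) / a) (𝓝[>] 0) (𝓝 c) := by
  rw [Metric.tendsto_nhds]
  intro ε hε
  set e := 1 - Real.exp (-1) with he
  have he0 : 0 < e := by
    rw [he, sub_pos, ← Real.exp_zero]; exact Real.exp_lt_exp.2 (by norm_num)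
  obtain ⟨s, hs, u, hu, hsu⟩ := mem_prod_iff.1 (Metric.tendsto_nhds.1 hlim (ε / 4) (by positivity))
  obtain ⟨δ, hδ, hδu⟩ := mem_nhdsGE_iff_exists_Ico_subset.1 hu
  have hδ0 : 0 < δ := hδ
  -- Beyond `N` the bound on `D a z / a` is only `C / a`. It is compensated by the tail estimate `a
  -- ψ(1/N) / (1 - e^{-1})`, whose coefficient is small since `ψ(1/N) → 0`. Between `δ` and `N` the
  -- quotient is bounded and the probability is `O(a)`; below `δ` it is close to `c`.
  obtain ⟨N, hNδ, hN⟩ : ∃ N, δ ≤ N ∧ (|C| + 1) * (laplaceExponent β ν N⁻¹ / e) ≤ ε / 4 := by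
    have h1 : Tendsto (fun N : ℝ => (|C| + 1) * (laplaceExponent β ν N⁻¹ / e)) atTop (𝓝 0) := by
      have := (((tendsto_laplaceExponent_zero (β := β) h.levyMeasure).comp
        tendsto_inv_atTop_nhdsGT_zero).div_const e).const_mul (|C| + 1)
      simpa using this
    obtain ⟨N, h2, h3⟩ := ((eventually_ge_atTop δ).and
      (h1.eventually_lt_const (show 0 < ε / 4 by positivity))).exists
    exact ⟨N, h2, h3.le⟩
  have hN0 : 0 < N := hδ0.trans_le hNδ
  obtain ⟨B, hB⟩ := hloc N
  have hsmall : Tendsto (fun a : ℝ≥0 => (|B| + |c|) * (a * laplaceExponent β ν δ⁻¹ / e)) (𝓝[>] 0)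
      (𝓝 0) := by
    have : Continuous fun a : ℝ≥0 => (|B| + |c|) * (a * laplaceExponent β ν δ⁻¹ / e) := by fun_prop
    have h1 := (this.tendsto 0).mono_left (nhdsWithin_le_nhds (s := Ioi 0))
    simpa using h1
  filter_upwards [hs, hB, hC, self_mem_nhdsWithin,
    hsmall.eventually_lt_const (show 0 < ε / 4 by positivity)] with a has haB haC ha hasmall
  have ha0 : (0 : ℝ) < a := by exact_mod_cast ha
  have hpr := h.isProbability a
  have hDint : Integrable (fun z => D a z / a) (m a) := by
    refine (integrable_const (C / a)).mono' ((hD a).div_const _).aestronglyMeasurable ?_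
    filter_upwards [h.nonneg a] with z hz
    rw [Real.norm_eq_abs, abs_div, abs_of_pos ha0]
    gcongr
    exact haC z hz
  have hi1 : Integrable ((Ici δ).indicator fun _ => |B| + |c|) (m a) :=
    (integrable_const _).indicator measurableSet_Ici
  have hi2 : Integrable ((Ici N).indicator fun _ => |C| / a) (m a) :=
    (integrable_const _).indicator measurableSet_Ici
  have hi0 : Integrable (fun z => ε / 4 + (Ici δ).indicator (fun _ => |B| + |c|) z) (m a) :=
    (integrable_const _).add hi1
  have hptw : ∀ z, 0 ≤ z → |D a z / a - c| ≤ ε / 4 + (Ici δ).indicator (fun _ => |B| + |c|) z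
      + (Ici N).indicator (fun _ => |C| / a) z := by
    intro z hz
    have hc1 : |D a z / a - c| ≤ |D a z| / a + |c| := by
      refine (abs_sub _ _).trans ?_
      rw [abs_div, abs_of_pos ha0]
    rcases lt_or_ge z δ with hzδ | hzδ
    · have h1 : dist (D a z / a) c < ε / 4 := hsu (mk_mem_prod has (hδu ⟨hz, hzδ⟩))
      rw [indicator_of_notMem (by simpa using hzδ),
        indicator_of_notMem (by simpa using hzδ.trans_le hNδ)]
      rw [Real.dist_eq] at h1
      linarith
    rw [indicator_of_mem (mem_Ici.2 hzδ)]
    rcases lt_or_ge z N with hzN | hzN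
    · rw [indicator_of_notMem (by simpa using hzN)]
      have h1 : |D a z| / a ≤ |B| := by
        rw [div_le_iff₀ ha0]
        refine (haB z hz hzN.le).trans ?_
        gcongr
        exact le_abs_self B
      linarith
    · rw [indicator_of_mem (mem_Ici.2 hzN)]
      have h1 : |D a z| / a ≤ |C| / a :=
        div_le_div_of_nonneg_right ((haC z hz).trans (le_abs_self C)) ha0.le
      linarith [abs_nonneg B]
  have h1 : (∫ z, D a z ∂(m a)) / a - c = ∫ z, (D a z / a - c) ∂(m a) := by
    rw [integral_sub hDint (integrable_const _), integral_div]; simp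
  rw [Real.dist_eq, h1]
  have hδm : (m a).real (Ici δ) ≤ a * laplaceExponent β ν δ⁻¹ / e := by
    rw [le_div_iff₀ he0]; exact h.measure_Ici_le a hδ0
  have hNm : (m a).real (Ici N) ≤ a * laplaceExponent β ν N⁻¹ / e := by
    rw [le_div_iff₀ he0]; exact h.measure_Ici_le a hN0
  have hlast : |C| / a * (m a).real (Ici N) ≤ ε / 4 := by
    have h0 : 0 ≤ laplaceExponent β ν N⁻¹ :=
      laplaceExponent_nonneg h.drift_nonneg (inv_pos.2 hN0).le
    calc |C| / a * (m a).real (Ici N) ≤ |C| / a * (a * laplaceExponent β ν N⁻¹ / e) := by gcongr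
      _ = |C| * (laplaceExponent β ν N⁻¹ / e) := by field_simp
      _ ≤ (|C| + 1) * (laplaceExponent β ν N⁻¹ / e) := by gcongr; linarith
      _ ≤ ε / 4 := hN
  calc |∫ z, (D a z / a - c) ∂(m a)| ≤ ∫ z, |D a z / a - c| ∂(m a) := abs_integral_le_integral_abs
    _ ≤ ∫ z, (ε / 4 + (Ici δ).indicator (fun _ => |B| + |c|) z
          + (Ici N).indicator (fun _ => |C| / a) z) ∂(m a) := by
        refine integral_mono_of_nonneg (.of_forall fun z => abs_nonneg _)
          (hi0.add hi2) ?_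
        filter_upwards [h.nonneg a] with z hz using hptw z hz
    _ = ε / 4 + (|B| + |c|) * (m a).real (Ici δ) + |C| / a * (m a).real (Ici N) := by
        rw [integral_add hi0 hi2, integral_add (integrable_const _) hi1,
          integral_indicator measurableSet_Ici, integral_indicator measurableSet_Ici]
        simp [mul_comm]
    _ < ε := by
        have h2 : (|B| + |c|) * (m a).real (Ici δ)
            ≤ (|B| + |c|) * (a * laplaceExponent β ν δ⁻¹ / e) := by gcongr
        linarith

/-! ### Scaling, convex order and the kernel of backward transition laws -/

lemma expNeg_pos (z : ℝ) : 0 < expNeg z := Real.toNNReal_pos.2 (Real.exp_pos _)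

@[simp]
lemma coe_expNeg (z : ℝ) : (expNeg z : ℝ) = Real.exp (-z) := Real.coe_toNNReal _ (Real.exp_pos _).le

lemma expNeg_mul_expNeg_neg (z : ℝ) : expNeg z * expNeg (-z) = 1 := by
  ext; simp [← Real.exp_add]

@[fun_prop]
lemma continuous_expNeg : Continuous expNeg := by unfold expNeg; fun_prop

lemma expNeg_strictAnti : StrictAnti expNeg := fun z w hzw => by
  rw [← NNReal.coe_lt_coe, coe_expNeg, coe_expNeg]; exact Real.exp_lt_exp.2 (by linarith)

lemma expNeg_zero : expNeg 0 = 1 := by ext; simp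

lemma mem_states_of_pos {t : ℝ≥0} (ht : 0 < t) (x : ℝ) : x ∈ states t := fun h => absurd h ht.ne'

/-- Jensen's inequality for extended nonnegative integrals. -/
lemma ofReal_le_lintegral_of_convexOn {π : Measure ℝ} [IsProbabilityMeasure π]
    (hi : Integrable (fun y => y) π) {φ : ℝ → ℝ} (hφ : ConvexOn ℝ univ φ) (hc : Continuous φ)
    (h0 : ∀ y, 0 ≤ φ y) :
    ENNReal.ofReal (φ (∫ y, y ∂π)) ≤ ∫⁻ y, ENNReal.ofReal (φ y) ∂π := by
  by_cases hfin : ∫⁻ y, ENNReal.ofReal (φ y) ∂π = ∞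
  · rw [hfin]; exact le_top
  have hφi : Integrable φ π :=
    ⟨hc.aestronglyMeasurable, (hasFiniteIntegral_iff_ofReal (.of_forall h0)).2
      (lt_top_iff_ne_top.2 hfin)⟩
  rw [← ofReal_integral_eq_lintegral_ofReal hφi (.of_forall h0)]
  exact ENNReal.ofReal_le_ofReal
    (hφ.map_integral_le hc.continuousOn isClosed_univ (.of_forall fun _ => mem_univ _) hi hφi)

/-- Under a scaling property, starting earlier is the same as ending later. -/
lemma IsScaling.map_eq {P : ℝ≥0 → ℝ≥0 → ℝ → Measure ℝ} {κ : ℝ} (hP : IsScaling P κ) {t : ℝ≥0}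
    (ht : 0 < t) (x : ℝ) {z : ℝ} (hz : 0 ≤ z) :
    P (t * expNeg z) t (x * Real.exp (-(z * κ))) =
      (P t (t * expNeg (-z)) x).map (fun y => Real.exp (-(z * κ)) * y) := by
  have h1 : 1 ≤ expNeg (-z) := by
    rw [← expNeg_zero]; exact expNeg_strictAnti.antitone (by linarith)
  have h2 := hP (expNeg z) (expNeg_pos z) t (t * expNeg (-z)) (le_mul_of_one_le_right' h1) x
    (mem_states_of_pos ht x)
  have h3 : (expNeg z : ℝ) ^ κ = Real.exp (-(z * κ)) := by
    rw [coe_expNeg, ← Real.exp_mul]; ring_nf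
  rw [h3] at h2
  rw [← h2, mul_comm t (expNeg z), mul_comm x]
  congr 1
  rw [mul_left_comm, expNeg_mul_expNeg_neg, mul_one]

/-- By Chapman-Kolmogorov, a later law arises from an earlier one through a kernel whose means are
the starting points; Jensen's inequality under this kernel gives the convex order. -/
lemma isConvexFlow_transition {P : ℝ≥0 → ℝ≥0 → ℝ → Measure ℝ} {κ : ℝ}
    (hP : IsTransitionFunction P) (hs : IsScaling P κ) (hm : IsMartingaleTransition P)
    (hr : IsRightContinuousTransition P) {p : ℝ} (hp : HasBoundedMoments P κ p) {t : ℝ≥0}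
    (ht : 0 < t) (x : ℝ) :
    IsConvexFlow (fun z => P t (t * expNeg (-z)) x) x (max p 1) where
  isProbability z hz := hP.isProbability _ _ _ <| le_mul_of_one_le_right' <| by
    rw [← expNeg_zero]; exact expNeg_strictAnti.antitone (by linarith)
  zero := by
    simp only [neg_zero, expNeg_zero, mul_one]
    exact hP.refl t x (mem_states_of_pos ht x)
  rightContinuous z hz g := by
    have h1 : t ≤ t * expNeg (-z) := le_mul_of_one_le_right' <| by
      rw [← expNeg_zero]; exact expNeg_strictAnti.antitone (by linarith)
    refine (hr t _ h1 x (mem_states_of_pos ht x) g).comp ?_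
    refine tendsto_nhdsWithin_iff.2 ⟨?_, ?_⟩
    · have : Continuous fun w : ℝ => t * expNeg (-w) := by fun_prop
      exact (this.tendsto z).mono_left nhdsWithin_le_nhds
    · filter_upwards [self_mem_nhdsWithin] with w hw
      have hw' : z < w := hw
      exact mul_lt_mul_of_pos_left (expNeg_strictAnti (by linarith)) ht
  lintegral_mono z w hz hzw φ hφ hc h0 := by
    have h1 : t ≤ t * expNeg (-z) := le_mul_of_one_le_right' <| by
      rw [← expNeg_zero]; exact expNeg_strictAnti.antitone (by linarith)
    have h2 : t * expNeg (-z) ≤ t * expNeg (-w) :=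
      mul_le_mul_right (expNeg_strictAnti.antitone (by linarith)) t
    rw [← hP.chapmanKolmogorov t _ _ h1 h2 x (mem_states_of_pos ht x),
      Measure.lintegral_bind (hP.measurable _ _ h2).aemeasurable (by fun_prop)]
    refine lintegral_mono fun y => ?_
    have h3 := hm _ _ h2 y (mem_states_of_pos (mul_pos ht (expNeg_pos _)) y)
    have h4 := hP.isProbability _ _ y h2
    have h5 := ofReal_le_lintegral_of_convexOn h3.1 hφ hc h0
    rwa [h3.2] at h5
  one_le := le_max_right _ _
  lintegral_lt_top z hz := by
    -- For `p ≤ 1` the exponent is `1` and the martingale property gives the first moment. Otherwise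
    -- the assumed moment bound applies, after undoing a dilation by a positive factor.
    rcases le_total p 1 with hp1 | hp1
    · have h1 : t ≤ t * expNeg (-z) := le_mul_of_one_le_right' <| by
        rw [← expNeg_zero]; exact expNeg_strictAnti.antitone (by linarith)
      have h2 := (hm _ _ h1 x (mem_states_of_pos ht x)).1.abs
      simp only [max_eq_right hp1, Real.rpow_one]
      exact (hasFiniteIntegral_iff_ofReal (.of_forall fun y => abs_nonneg y)).1 h2.2
    · obtain ⟨M, hM⟩ := hp t ht x
      have h1 := hM z hz
      have hp0 : 0 ≤ p := by linarith
      have hmeas : Measurable fun y : ℝ => ENNReal.ofReal (|y| ^ p) :=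
        (continuous_abs_rpow hp0).measurable.ennreal_ofReal
      rw [hs.map_eq ht x hz, lintegral_map hmeas (by fun_prop)] at h1
      simp_rw [abs_mul, abs_of_pos (Real.exp_pos _), Real.mul_rpow (Real.exp_pos _).le (abs_nonneg _)]
        at h1
      have h2 : 0 < Real.exp (-(z * κ)) ^ p := by positivity
      simp_rw [ENNReal.ofReal_mul h2.le] at h1
      rw [lintegral_const_mul _ hmeas] at h1
      rw [max_eq_left hp1]
      by_contra htop
      rw [not_lt, top_le_iff] at htop
      rw [htop, ENNReal.mul_top (by simpa using h2)] at h1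
      exact absurd (top_le_iff.1 h1) ENNReal.coe_ne_top

/-- `f` is the pointwise limit of step functions: `z` is replaced by the next point of the grid of
mesh `1/(n+1)` strictly to its right, which tends to `z` from the right. -/
lemma measurable_of_continuousWithinAt_Ici {f : ℝ → ℝ}
    (h : ∀ z, ContinuousWithinAt f (Ici z) z) : Measurable f := by
  set s : ℕ → ℝ → ℝ := fun n z => (⌊(n + 1) * z⌋ + 1) / (n + 1 : ℝ) with hs
  have hmeas : ∀ n, Measurable fun z => f (s n z) := fun n =>
    (measurable_from_top (f := fun k : ℤ => f ((k + 1) / (n + 1 : ℝ)))).comp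
      (Int.measurable_floor.comp (measurable_const_mul _))
  refine measurable_of_tendsto_metrizable hmeas (tendsto_pi_nhds.2 fun z => ?_)
  have hge : ∀ n, z ≤ s n z := fun n => by
    have hn : (0 : ℝ) < n + 1 := by positivity
    rw [hs]
    simp only
    rw [le_div_iff₀ hn, mul_comm]
    exact (Int.lt_floor_add_one _).le
  have hle : ∀ n, s n z ≤ z + 1 / (n + 1 : ℝ) := fun n => by
    have hn : (0 : ℝ) < n + 1 := by positivity
    rw [hs]
    simp only
    have h1 : (z + 1 / (n + 1 : ℝ)) * (n + 1) = (n + 1) * z + 1 := by field_simp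
    rw [div_le_iff₀ hn, h1]
    linarith [Int.floor_le ((n + 1) * z)]
  refine (h z).tendsto.comp (tendsto_nhdsWithin_iff.2 ⟨?_, .of_forall hge⟩)
  refine tendsto_of_tendsto_of_tendsto_of_le_of_le tendsto_const_nhds ?_ hge hle
  simpa using tendsto_const_nhds.add (tendsto_one_div_add_atTop_nhds_zero_nat (𝕜 := ℝ))

/-- Closed sets form a generating π-system, and the indicator of a closed set is a pointwise limit
of bounded continuous functions, its thickened indicators. -/
lemma measurable_of_measurable_integral {K : ℝ → Measure ℝ} [∀ z, IsProbabilityMeasure (K z)]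
    (h : ∀ g : BoundedContinuousFunction ℝ ℝ, Measurable fun z => ∫ y, g y ∂(K z)) :
    Measurable K := by
  refine Measurable.measure_of_isPiSystem_of_isProbabilityMeasure
    borel_eq_generateFrom_isClosed isPiSystem_isClosed fun F hF => ?_
  have hF : IsClosed F := hF
  have hδ : ∀ n : ℕ, (0 : ℝ) < 1 / (n + 1 : ℝ) := fun n => by positivity
  refine measurable_of_tendsto_metrizable
    (f := fun (n : ℕ) z => ∫⁻ y, (thickenedIndicator (hδ n) F y : ℝ≥0∞) ∂(K z)) (fun n => ?_)
    (tendsto_pi_nhds.2 fun z => tendsto_lintegral_thickenedIndicator_of_isClosed (K z) hF hδ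
      (tendsto_one_div_add_atTop_nhds_zero_nat (𝕜 := ℝ)))
  let g : BoundedContinuousFunction ℝ ℝ := BoundedContinuousFunction.ofNormedAddCommGroup
    (fun y => (thickenedIndicator (hδ n) F y : ℝ))
    (NNReal.continuous_coe.comp (thickenedIndicator (hδ n) F).continuous) 1 fun y => by
      rw [Real.norm_of_nonneg (NNReal.coe_nonneg _)]
      exact_mod_cast thickenedIndicator_le_one (hδ n) F y
  have hg : ∀ z, ∫⁻ y, (thickenedIndicator (hδ n) F y : ℝ≥0∞) ∂(K z)
      = ENNReal.ofReal (∫ y, g y ∂(K z)) := fun z => by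
    rw [ofReal_integral_eq_lintegral_ofReal (g.integrable _)
      (.of_forall fun y => NNReal.coe_nonneg _)]
    refine lintegral_congr fun y => ?_
    exact (ENNReal.ofReal_coe_nnreal).symm
  simp_rw [hg]
  exact (h g).ennreal_ofReal

/-- Weak right-continuity makes the integrals of bounded continuous functions right-continuous in
`z`, hence measurable. The positive part extends the flow to all real `z`. -/
lemma IsConvexFlow.measurable {Q : ℝ → Measure ℝ} {x q : ℝ} (h : IsConvexFlow Q x q) :
    Measurable fun z => Q (max z 0) := by
  have hp : ∀ z, IsProbabilityMeasure (Q (max z 0)) := fun z =>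
    h.isProbability _ (le_max_right _ _)
  refine measurable_of_measurable_integral fun g => ?_
  refine measurable_of_continuousWithinAt_Ici fun z => ?_
  have h1 : ContinuousWithinAt (fun w => ∫ y, g y ∂(Q w)) (Ici (max z 0)) (max z 0) :=
    continuousWithinAt_Ioi_iff_Ici.1 (h.rightContinuous _ (le_max_right _ _) g)
  exact h1.comp (t := Ici (max z 0)) (f := fun w : ℝ => max w 0) (by fun_prop)
    fun w (hw : z ≤ w) => mem_Ici.2 (max_le_max_right 0 hw)

/-- The laws `P(t e^{-z}, t, x e^{-zκ}, dy)`, `z ≥ 0`, form a Markov kernel. -/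
lemma exists_kernel_eq {P : ℝ≥0 → ℝ≥0 → ℝ → Measure ℝ} {κ q : ℝ} (hs : IsScaling P κ) {t : ℝ≥0}
    (ht : 0 < t) (x : ℝ) (hQ : IsConvexFlow (fun z => P t (t * expNeg (-z)) x) x q) :
    ∃ K : Kernel ℝ ℝ, IsMarkovKernel K ∧
      ∀ z, K z = P (t * expNeg (max z 0)) t (x * Real.exp (-(max z 0 * κ))) := by
  have hp : ∀ z : ℝ, IsProbabilityMeasure (P t (t * expNeg (-(max z 0))) x) := fun z =>
    hQ.isProbability _ (le_max_right _ _)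
  let K₀ : Kernel ℝ ℝ := ⟨_, hQ.measurable⟩
  have hK₀ : ∀ z, K₀ z = P t (t * expNeg (-(max z 0))) x := fun z => rfl
  have : IsMarkovKernel K₀ := ⟨hp⟩
  have hmul : ∀ z : ℝ, Measurable fun y : ℝ => Real.exp (-(max z 0 * κ)) * y := fun z => by
    fun_prop
  have heq : ∀ z, P (t * expNeg (max z 0)) t (x * Real.exp (-(max z 0 * κ)))
      = (K₀ z).map fun y => Real.exp (-(max z 0 * κ)) * y := fun z => by
    rw [hs.map_eq ht x (le_max_right z 0), hK₀]
  refine ⟨⟨fun z => P (t * expNeg (max z 0)) t (x * Real.exp (-(max z 0 * κ))), ?_⟩, ⟨fun z => ?_⟩,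
    fun z => rfl⟩
  · simp_rw [heq]
    refine Measure.measurable_of_measurable_coe _ fun B hB => ?_
    simp_rw [Measure.map_apply (hmul _) hB]
    -- The dilation factor also depends on `z`, so the preimages of `B` are sections of one
    -- measurable subset of the plane.
    have hset : MeasurableSet {p : ℝ × ℝ | Real.exp (-(max p.1 0 * κ)) * p.2 ∈ B} :=
      (by fun_prop : Measurable fun p : ℝ × ℝ => Real.exp (-(max p.1 0 * κ)) * p.2) hB
    exact Kernel.measurable_kernel_prodMk_left hset
  · change IsProbabilityMeasure (P _ _ _)
    rw [heq]
    exact Measure.isProbabilityMeasure_map (hmul z).aemeasurable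

/-- The mimic's transition function is a mixture of dilated transition probabilities. -/
lemma mimicTransition_eq {Ω : Type*} [MeasurableSpace Ω] {P : ℝ≥0 → ℝ≥0 → ℝ → Measure ℝ} {κ : ℝ}
    {ζ : ℝ≥0 → Ω → ℝ} {μ : Measure Ω} (hs : IsScaling P κ) (hζ : ∀ a, Measurable (ζ a))
    (h0 : ∀ a ω, 0 ≤ ζ a ω) {t u : ℝ≥0} (ht : 0 < t) (htu : t ≤ u) (x : ℝ) (K : Kernel ℝ ℝ)
    (hK : ∀ z, K z = P (t * expNeg (max z 0)) t (x * Real.exp (-(max z 0 * κ)))) :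
    mimicTransition P κ ζ μ t u x =
      (K ∘ₘ μ.map (ζ (Real.toNNReal (Real.log (u / t : ℝ≥0))))).map
        (fun y => ((u / t : ℝ≥0) : ℝ) ^ κ * y) := by
  set a := Real.toNNReal (Real.log (u / t : ℝ≥0)) with ha
  have hu : 0 < u := ht.trans_le htu
  have hρ : Measurable fun y : ℝ => ((u / t : ℝ≥0) : ℝ) ^ κ * y := by fun_prop
  have hR : randomFactor ζ (u / t) = fun ω => expNeg (ζ a ω) := rfl
  have hRm : Measurable fun ω => expNeg (ζ a ω) := continuous_expNeg.measurable.comp (hζ a)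
  rw [mimicTransition, if_neg ht.ne', hR]
  -- A measurable version, defined for every `r`, of the integrand in the mixture. The two agree for
  -- `r` in `(0, 1]`, where the random factor takes its values, since there `r = e^{-z}` with `z =
  -- -log r ≥ 0`.
  set F' : ℝ≥0 → Measure ℝ := fun r =>
    (K (-Real.log r)).map (fun y => ((u / t : ℝ≥0) : ℝ) ^ κ * y) with hF'
  have hF'm : Measurable F' :=
    (Measure.measurable_map _ hρ).comp (K.measurable.comp (by fun_prop))
  have hval : ∀ z, 0 ≤ z → P (expNeg z * u) u (((u / t : ℝ≥0) : ℝ) ^ κ * (expNeg z : ℝ) ^ κ * x)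
      = F' (expNeg z) := by
    intro z hz
    have h1 : (expNeg z : ℝ) ^ κ = Real.exp (-(z * κ)) := by
      rw [coe_expNeg, ← Real.exp_mul]; ring_nf
    have h2 : expNeg z ≤ 1 := by rw [← expNeg_zero]; exact expNeg_strictAnti.antitone hz
    have h3 := hs (u / t) (div_pos hu ht) (t * expNeg z) t (mul_le_of_le_one_right' h2)
      (x * Real.exp (-(z * κ))) (mem_states_of_pos (mul_pos ht (expNeg_pos z)) _)
    have h4 : u / t * (t * expNeg z) = expNeg z * u := by
      rw [← mul_assoc, div_mul_cancel₀ _ ht.ne', mul_comm]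
    rw [h4, div_mul_cancel₀ _ ht.ne'] at h3
    simp only [hF', coe_expNeg, Real.log_exp, neg_neg, hK, max_eq_left hz]
    rw [← h3, ← coe_expNeg, h1, mul_assoc, mul_comm x]
  have hae : ∀ᵐ r ∂μ.map (fun ω => expNeg (ζ a ω)),
      P (r * u) u (((u / t : ℝ≥0) : ℝ) ^ κ * (r : ℝ) ^ κ * x) = F' r := by
    have hsub : range (fun ω => expNeg (ζ a ω)) ⊆ Ioc 0 1 := by
      rintro _ ⟨ω, rfl⟩
      refine ⟨expNeg_pos _, ?_⟩
      rw [← expNeg_zero]; exact expNeg_strictAnti.antitone (h0 a ω)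
    have h1 : ∀ᵐ r ∂μ.map (fun ω => expNeg (ζ a ω)), r ∈ Ioc (0 : ℝ≥0) 1 :=
      (ae_map_iff hRm.aemeasurable measurableSet_Ioc).2
        (.of_forall fun ω => hsub (mem_range_self ω))
    filter_upwards [h1] with r hr
    have hr0 : (0 : ℝ) < r := by exact_mod_cast hr.1
    have h2 : expNeg (-Real.log r) = r := by
      ext; rw [coe_expNeg, neg_neg, Real.exp_log hr0]
    have h3 := hval (-Real.log r) (by
      rw [neg_nonneg]; exact Real.log_nonpos hr0.le (by exact_mod_cast hr.2))
    rwa [h2] at h3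
  rw [Measure.bind_congr_right hae]
  ext B hB
  rw [Measure.bind_apply hB hF'm.aemeasurable,
    lintegral_map (f := fun r => F' r B) ((Measure.measurable_coe hB).comp hF'm) hRm, Measure.map_apply hρ hB,
    Measure.bind_apply (hρ hB) K.aemeasurable,
    lintegral_map (K.measurable_coe (hρ hB)) (hζ a)]
  refine lintegral_congr fun ω => ?_
  simp only [hF', coe_expNeg, Real.log_exp, neg_neg]
  rw [Measure.map_apply hρ hB]

lemma integral_comp_measure {K : Kernel ℝ ℝ} [IsMarkovKernel K] {m : Measure ℝ} [SFinite m]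
    {g : ℝ → ℝ} (hg : Integrable g (K ∘ₘ m)) :
    ∫ y, g y ∂(K ∘ₘ m) = ∫ z, ∫ y, g y ∂(K z) ∂m := by
  rw [Measure.comp_eq_comp_const_apply] at hg ⊢
  rw [Kernel.integral_comp hg, Kernel.const_apply]

/-! ### Regularity of the integrals of `f` along the dilated flow -/

namespace IsConvexFlow

variable {Q : ℝ → Measure ℝ} {x q κ C : ℝ} {f : ℝ → ℝ}

lemma exp_neg_mul_mem_Ioc (hκ : 0 < κ) {z : ℝ} (hz : 0 ≤ z) :
    Real.exp (-(z * κ)) ∈ Ioc (0 : ℝ) 1 :=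
  ⟨Real.exp_pos _, Real.exp_le_one_iff.2 (by nlinarith)⟩

lemma integrable_dilation (h : IsConvexFlow Q x q) (hf : Continuous f)
    (hg : ∀ y, |f y| ≤ C * (1 + |y| ^ q)) (ρ : ℝ) {z : ℝ} (hz : 0 ≤ z) :
    Integrable (fun y => f (ρ * y)) (Q z) := by
  have := h.isProbability z hz
  have h1 : Integrable (fun y : ℝ => C * (1 + |ρ| ^ q * |y| ^ q)) (Q z) :=
    ((integrable_const _).add ((h.integrable_abs_rpow hz).const_mul _)).const_mul C
  refine h1.mono' (by fun_prop) (.of_forall fun y => ?_)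
  rw [← Real.mul_rpow (abs_nonneg _) (abs_nonneg _), ← abs_mul]
  exact hg _

/-- The bound is uniform over the times `z ≤ w`, because moments of order `q` increase along the
flow. -/
lemma abs_integral_dilation_sub_le (h : IsConvexFlow Q x q) (hf : Continuous f)
    (hg : ∀ y, |f y| ≤ C * (1 + |y| ^ q))
    (hC : ∀ α γ y : ℝ, 0 ≤ α → α ≤ 2 → 0 ≤ γ → γ ≤ 2 →
      |f (α * y) - f (γ * y)| ≤ |α - γ| * (C * (1 + |y| ^ q)))
    (hC0 : 0 ≤ C) {α γ : ℝ} (hα : α ∈ Icc (0 : ℝ) 2) (hγ : γ ∈ Icc (0 : ℝ) 2)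
    {z w : ℝ} (hz : 0 ≤ z) (hzw : z ≤ w) :
    |∫ y, f (α * y) ∂(Q z) - ∫ y, f (γ * y) ∂(Q z)|
      ≤ |α - γ| * (C * ∫ y, (1 + |y| ^ q) ∂(Q w)) := by
  have := h.isProbability z hz
  rw [← integral_sub (h.integrable_dilation hf hg α hz) (h.integrable_dilation hf hg γ hz)]
  refine abs_integral_le_integral_abs.trans ?_
  have hi : Integrable (fun y : ℝ => 1 + |y| ^ q) (Q z) :=
    (integrable_const _).add (h.integrable_abs_rpow hz)
  refine (integral_mono_of_nonneg (.of_forall fun y => abs_nonneg _)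
    ((hi.const_mul C).const_mul |α - γ|)
    (.of_forall fun y => hC α γ y hα.1 hα.2 hγ.1 hγ.2)).trans ?_
  rw [integral_const_mul, integral_const_mul]
  exact mul_le_mul_of_nonneg_left
    (mul_le_mul_of_nonneg_left (h.integral_growth_le hz hzw) hC0) (abs_nonneg _)

lemma continuousWithinAt_integral_exp (h : IsConvexFlow Q x q) (hκ : 0 < κ) (hf : Continuous f)
    (hg : ∀ y, |f y| ≤ C * (1 + |y| ^ q))
    (hC : ∀ α γ y : ℝ, 0 ≤ α → α ≤ 2 → 0 ≤ γ → γ ≤ 2 →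
      |f (α * y) - f (γ * y)| ≤ |α - γ| * (C * (1 + |y| ^ q)))
    (hC0 : 0 ≤ C) {z : ℝ} (hz : 0 ≤ z) :
    ContinuousWithinAt (fun w => ∫ y, f (Real.exp (-(w * κ)) * y) ∂(Q w)) (Ici z) z := by
  have hmem : ∀ w, 0 ≤ w → Real.exp (-(w * κ)) ∈ Icc (0 : ℝ) 2 := fun w hw =>
    ⟨(exp_neg_mul_mem_Ioc hκ hw).1.le, (exp_neg_mul_mem_Ioc hκ hw).2.trans one_le_two⟩
  have h1 : ContinuousWithinAt (fun w => ∫ y, f (Real.exp (-(z * κ)) * y) ∂(Q w)) (Ici z) z := by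
    refine h.continuousWithinAt_integral hz (C := C) (by fun_prop) fun y => (hg _).trans ?_
    have h2 := exp_neg_mul_mem_Ioc hκ hz
    have h3 : |Real.exp (-(z * κ)) * y| ≤ |y| := by
      rw [abs_mul, abs_of_pos h2.1]
      exact mul_le_of_le_one_left (abs_nonneg y) h2.2
    have := h.nonneg
    gcongr
  set B := C * ∫ y, (1 + |y| ^ q) ∂(Q (z + 1)) with hB
  have h2 : Tendsto (fun w => ∫ y, f (Real.exp (-(w * κ)) * y) ∂(Q w)
      - ∫ y, f (Real.exp (-(z * κ)) * y) ∂(Q w)) (𝓝[≥] z) (𝓝 0) := by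
    have h3 : Tendsto (fun w => |Real.exp (-(w * κ)) - Real.exp (-(z * κ))| * B) (𝓝[≥] z)
        (𝓝 0) := by
      have h4 : Continuous fun w => |Real.exp (-(w * κ)) - Real.exp (-(z * κ))| * B := by
        fun_prop
      have h5 := (h4.tendsto z).mono_left (nhdsWithin_le_nhds (s := Ici z))
      simpa using h5
    refine squeeze_zero_norm' ?_ h3
    filter_upwards [Icc_mem_nhdsGE (show z < z + 1 by linarith)] with w hw
    exact h.abs_integral_dilation_sub_le hf hg hC hC0 (hmem w (hz.trans hw.1)) (hmem z hz)
      (hz.trans hw.1) hw.2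
  have h6 := h2.add h1.tendsto
  rw [zero_add] at h6
  exact h6.congr fun w => by ring

lemma tendsto_exp_sub_one_div (κ : ℝ) :
    Tendsto (fun a : ℝ => (Real.exp (a * κ) - 1) / a) (𝓝[>] 0) (𝓝 κ) := by
  have hd : HasDerivAt (fun a : ℝ => Real.exp (a * κ)) κ 0 := by
    simpa using ((hasDerivAt_id' (0 : ℝ)).mul_const κ).exp
  refine hd.tendsto_slope_zero_right.congr fun a => ?_
  simp only [zero_add, zero_mul, Real.exp_zero, smul_eq_mul]
  ring

/-- A product rule at `z = 0`: the flow contributes `l`, and the factor `e^{-zκ}`, with derivative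
`-κ`, contributes `-κ x f'(x)`. -/
lemma tendsto_slope_integral_exp (h : IsConvexFlow Q x q) (hf : ContDiff ℝ 1 f)
    (hg : ∀ y, |f y| ≤ C * (1 + |y| ^ q))
    (hC : ∀ α γ y : ℝ, 0 ≤ α → α ≤ 2 → 0 ≤ γ → γ ≤ 2 →
      |f (α * y) - f (γ * y)| ≤ |α - γ| * (C * (1 + |y| ^ q)))
    {l : ℝ} (hl : Tendsto (fun z => (∫ y, f y ∂(Q z) - f x) / z) (𝓝[>] 0) (𝓝 l)) :
    Tendsto (fun z => (∫ y, f (Real.exp (-(z * κ)) * y) ∂(Q z) - f x) / z) (𝓝[>] 0)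
      (𝓝 (l - κ * x * deriv f x)) := by
  have hzi : Tendsto (fun z : ℝ => z) (𝓝[>] 0) (𝓝[≥] 0) :=
    tendsto_id.mono_left (nhdsWithin_mono _ Ioi_subset_Ici_self)
  have hα : Tendsto (fun z : ℝ => Real.exp (-(z * κ))) (𝓝[>] 0) (𝓝 1) := by
    have h1 : Continuous fun z : ℝ => Real.exp (-(z * κ)) := by fun_prop
    simpa using (h1.tendsto 0).mono_left (nhdsWithin_le_nhds (s := Ioi 0))
  have hd : Tendsto (fun z : ℝ => (Real.exp (-(z * κ)) - 1) / z) (𝓝[>] 0) (𝓝 (-κ)) := by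
    simpa using tendsto_exp_sub_one_div (-κ)
  have h1 := hl.add (h.tendsto_integral_dilation hzi hf hC hα tendsto_const_nhds hd)
  rw [show l + -κ * x * deriv f x = l - κ * x * deriv f x by ring] at h1
  refine h1.congr' ?_
  filter_upwards [self_mem_nhdsWithin] with z hz
  have hz0 : 0 ≤ z := le_of_lt hz
  simp only [one_mul]
  rw [integral_div, integral_sub (h.integrable_dilation hf.continuous hg _ hz0)
    (h.integrable_of_growth hz0 hf.continuous.measurable hg)]
  ring

end IsConvexFlow

/-! ### The generator of the mimic -/

/-- Convergence of the difference quotients at time `t` of the mixture, over the law of a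
subordinator, of the dilated transition probabilities. -/
lemma tendsto_mixture {Q : ℝ → Measure ℝ} {x p κ C M : ℝ} {f : ℝ → ℝ} (hp : 0 ≤ p) (hκ : 0 < κ)
    (h : IsConvexFlow Q x (max p 1)) {K : Kernel ℝ ℝ} [IsMarkovKernel K]
    (hK : ∀ z, K z = (Q (max z 0)).map fun y => Real.exp (-(max z 0 * κ)) * y)
    (hKp : ∀ z, Integrable (fun y => |y| ^ p) (K z) ∧ ∫ y, |y| ^ p ∂(K z) ≤ M)
    (hf : ContDiff ℝ 1 f) (hC0 : 0 ≤ C) (hfp : ∀ y, |f y| ≤ C * (1 + |y| ^ p))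
    (hg : ∀ y, |f y| ≤ C * (1 + |y| ^ max p 1))
    (hC : ∀ α γ y : ℝ, 0 ≤ α → α ≤ 2 → 0 ≤ γ → γ ≤ 2 →
      |f (α * y) - f (γ * y)| ≤ |α - γ| * (C * (1 + |y| ^ max p 1)))
    {l : ℝ} (hl : Tendsto (fun z => (∫ y, f y ∂(Q z) - f x) / z) (𝓝[>] 0) (𝓝 l))
    {m : ℝ≥0 → Measure ℝ} {β : ℝ} {ν : Measure ℝ} (hm : IsSubordinatorLaw m β ν) :
    IntegrableOn (fun z => ∫ y, (f y - f x) ∂(K z)) (Ioi 0) ν ∧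
    Tendsto (fun a : ℝ≥0 => (∫ z, ∫ y, f (Real.exp (a * κ) * y) ∂(K z) ∂(m a) - f x) / a) (𝓝[>] 0)
      (𝓝 (β * (l - κ * x * deriv f x) + ∫ z in Ioi 0, (∫ y, (f y - f x) ∂(K z)) ∂ν
        + κ * x * deriv f x)) := by
  have hfc := hf.continuous
  have hpr := hm.isProbability
  have hpc := continuous_abs_rpow hp
  have hint : ∀ ρ z, Integrable (fun y => f (ρ * y)) (K z) := fun ρ z => by
    refine (((integrable_const (1 : ℝ)).add ((hKp z).1.const_mul (|ρ| ^ p))).const_mul C).mono'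
      (by fun_prop) (.of_forall fun y => (hfp _).trans_eq ?_)
    rw [abs_mul, Real.mul_rpow (abs_nonneg _) (abs_nonneg _)]
    rfl
  have hint1 : ∀ z, Integrable f (K z) := fun z => by simpa using hint 1 z
  have hM0 : 0 ≤ M := (integral_nonneg fun y => by positivity).trans (hKp 0).2
  have hbound : ∀ ρ z, |∫ y, f (ρ * y) ∂(K z)| ≤ C * (1 + |ρ| ^ p * M) := fun ρ z => by
    refine abs_integral_le_integral_abs.trans ?_
    have hi : Integrable (fun y : ℝ => 1 + |ρ| ^ p * |y| ^ p) (K z) :=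
      (integrable_const (1 : ℝ)).add ((hKp z).1.const_mul (|ρ| ^ p))
    refine (integral_mono_of_nonneg (.of_forall fun y => abs_nonneg _) (hi.const_mul C)
      (.of_forall fun y => (hfp _).trans_eq ?_)).trans ?_
    · rw [abs_mul, Real.mul_rpow (abs_nonneg _) (abs_nonneg _)]
    · rw [integral_const_mul, integral_add (integrable_const _) ((hKp z).1.const_mul _),
        integral_const_mul]
      simp only [integral_const, probReal_univ, smul_eq_mul, mul_one]
      gcongr
      exact (hKp z).2
  have hKQ : ∀ ρ z, 0 ≤ z →
      ∫ y, f (ρ * y) ∂(K z) = ∫ y, f (ρ * Real.exp (-(z * κ)) * y) ∂(Q z) := fun ρ z hz => by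
    rw [hK, max_eq_left hz, integral_map (by fun_prop) (by fun_prop)]
    simp_rw [mul_assoc]
  have hKQ1 : ∀ z, 0 ≤ z → ∫ y, f y ∂(K z) = ∫ y, f (Real.exp (-(z * κ)) * y) ∂(Q z) :=
    fun z hz => by simpa using hKQ 1 z hz
  have hmeas : ∀ ρ, Measurable fun z => ∫ y, f (ρ * y) ∂(K z) := fun ρ =>
    (StronglyMeasurable.integral_kernel (κ := K) (f := fun y => f (ρ * y))
      (Continuous.stronglyMeasurable (by fun_prop))).measurable
  set G : ℝ → ℝ := fun z => ∫ y, f y ∂(K z) with hGdef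
  have hGmeas : Measurable G := by simpa using hmeas 1
  have hGb : ∀ z, |G z| ≤ C * (1 + M) := fun z => by simpa using hbound 1 z
  have hG0 : G 0 = f x := by
    simp only [hGdef]
    rw [hKQ1 0 le_rfl, h.zero, integral_dirac]; simp
  have hGr : ∀ z, 0 ≤ z → ContinuousWithinAt G (Ici z) z := fun z hz =>
    (h.continuousWithinAt_integral_exp hκ hfc hg hC hC0 hz).congr
      (fun w hw => hKQ1 w (hz.trans hw)) (hKQ1 z hz)
  have hGD : Tendsto (fun z => (G z - G 0) / z) (𝓝[>] 0) (𝓝 (l - κ * x * deriv f x)) := by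
    refine (h.tendsto_slope_integral_exp hf hg hC hl).congr' ?_
    filter_upwards [self_mem_nhdsWithin] with z hz
    rw [hG0, ← hKQ1 z (le_of_lt hz)]
  have hGsub : ∀ z, ∫ y, (f y - f x) ∂(K z) = G z - G 0 := fun z => by
    rw [integral_sub (hint1 z) (integrable_const _), hG0]; simp [hGdef]
  simp_rw [hGsub]
  obtain ⟨hI, hT⟩ := hm.tendsto_integral_sub_div hGmeas hGb hGr hGD
  refine ⟨hI, ?_⟩
  -- The effect of the outer dilation by `e^{aκ}` alone. It is of order `a` locally uniformly in `z`
  -- and, by the moment bound, bounded for all `z ≥ 0` once `a` is small.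
  set D : ℝ≥0 → ℝ → ℝ := fun a z => ∫ y, f (Real.exp (a * κ) * y) ∂(K z) - G z with hD
  have hDmeas : ∀ a, Measurable (D a) := fun a => (hmeas _).sub hGmeas
  have hcoe : Tendsto (fun a : ℝ≥0 => (a : ℝ)) (𝓝[>] 0) (𝓝[>] 0) := by
    refine tendsto_nhdsWithin_iff.2 ⟨?_, ?_⟩
    · exact (NNReal.continuous_coe.tendsto 0).mono_left nhdsWithin_le_nhds
    · filter_upwards [self_mem_nhdsWithin] with a ha using by simpa using ha
  have hquot : Tendsto (fun a : ℝ≥0 => (Real.exp (a * κ) - 1) / a) (𝓝[>] 0) (𝓝 κ) :=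
    (IsConvexFlow.tendsto_exp_sub_one_div κ).comp hcoe
  have hexp1 : Tendsto (fun a : ℝ≥0 => Real.exp (a * κ)) (𝓝[>] 0) (𝓝 1) := by
    have h1 : Continuous fun a : ℝ≥0 => Real.exp (a * κ) := by fun_prop
    simpa using (h1.tendsto 0).mono_left (nhdsWithin_le_nhds (s := Ioi 0))
  have hge1 : ∀ a : ℝ≥0, 1 ≤ Real.exp (a * κ) := fun a => Real.one_le_exp (by positivity)
  have hDQ : ∀ a z, 0 ≤ z → D a z = ∫ y, f (Real.exp (a * κ) * Real.exp (-(z * κ)) * y) ∂(Q z)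
      - ∫ y, f (Real.exp (-(z * κ)) * y) ∂(Q z) := fun a z hz => by
    simp only [hD, hGdef]
    rw [hKQ _ z hz, hKQ1 z hz]
  have hDlim : Tendsto (fun r : ℝ≥0 × ℝ => D r.1 r.2 / r.1) (𝓝[>] 0 ×ˢ 𝓝[≥] 0)
      (𝓝 (κ * x * deriv f x)) := by
    have hγ : Tendsto (fun r : ℝ≥0 × ℝ => Real.exp (-(r.2 * κ))) (𝓝[>] 0 ×ˢ 𝓝[≥] 0) (𝓝 1) := by
      have h1 : Continuous fun z : ℝ => Real.exp (-(z * κ)) := by fun_prop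
      have h2 := (h1.tendsto 0).mono_left (nhdsWithin_le_nhds (s := Ici 0))
      simp only [zero_mul, neg_zero, Real.exp_zero] at h2
      exact h2.comp tendsto_snd
    have hα : Tendsto (fun r : ℝ≥0 × ℝ => Real.exp (r.1 * κ) * Real.exp (-(r.2 * κ)))
        (𝓝[>] 0 ×ˢ 𝓝[≥] 0) (𝓝 1) := by
      simpa using (hexp1.comp tendsto_fst).mul hγ
    have hd : Tendsto (fun r : ℝ≥0 × ℝ => (Real.exp (r.1 * κ) * Real.exp (-(r.2 * κ))
        - Real.exp (-(r.2 * κ))) / r.1) (𝓝[>] 0 ×ˢ 𝓝[≥] 0) (𝓝 κ) := by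
      have := (hquot.comp tendsto_fst).mul hγ
      rw [mul_one] at this
      refine this.congr fun r => ?_
      simp only [Function.comp_apply]; ring
    refine (h.tendsto_integral_dilation tendsto_snd hf hC hα hγ hd).congr' ?_
    have hev : ∀ᶠ r : ℝ≥0 × ℝ in 𝓝[>] 0 ×ˢ 𝓝[≥] 0, 0 ≤ r.2 :=
      tendsto_snd.eventually (self_mem_nhdsWithin : Ici (0 : ℝ) ∈ 𝓝[≥] 0)
    filter_upwards [hev] with r hr
    rw [integral_div, integral_sub (h.integrable_dilation hfc hg _ hr)
      (h.integrable_dilation hfc hg _ hr), hDQ _ _ hr]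
  have hDloc : ∀ N : ℝ, ∃ B : ℝ, ∀ᶠ a : ℝ≥0 in 𝓝[>] 0, ∀ z, 0 ≤ z → z ≤ N → |D a z| ≤ B * a := by
    intro N
    -- The difference of the two dilation factors is at most `e^{aκ} - 1 ≤ (κ + 1) a` for small `a`,
    -- and moments at times `z ≤ N` are at most those at time `N`.
    set I := C * ∫ y, (1 + |y| ^ max p 1) ∂(Q N) with hI
    refine ⟨(κ + 1) * I, ?_⟩
    filter_upwards [hquot.eventually_lt_const (show κ < κ + 1 by linarith),
      hexp1.eventually_lt_const one_lt_two, self_mem_nhdsWithin] with a ha1 ha2 ha0 z hz hzN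
    have ha : (0 : ℝ) < a := by exact_mod_cast ha0
    have h1 := IsConvexFlow.exp_neg_mul_mem_Ioc hκ hz
    rw [hDQ a z hz]
    have hI0 : 0 ≤ I := mul_nonneg hC0 (integral_nonneg fun y => by positivity)
    refine (h.abs_integral_dilation_sub_le hfc hg hC hC0
      ⟨by positivity, (mul_le_of_le_one_right (by positivity) h1.2).trans ha2.le⟩ ⟨h1.1.le, h1.2.trans one_le_two⟩ hz hzN).trans ?_
    rw [← hI, ← sub_one_mul, abs_mul, abs_of_pos h1.1, abs_of_nonneg (by linarith [hge1 a])]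
    rw [div_lt_iff₀ ha] at ha1
    have h2 : (Real.exp (a * κ) - 1) * Real.exp (-(z * κ)) ≤ (κ + 1) * a :=
      (mul_le_of_le_one_right (by linarith [hge1 a]) h1.2).trans ha1.le
    calc _ ≤ (κ + 1) * a * I := mul_le_mul_of_nonneg_right h2 hI0
      _ = _ := by ring
  have hDb : ∀ᶠ a : ℝ≥0 in 𝓝[>] 0, ∀ z, 0 ≤ z → |D a z| ≤ C * (1 + 2 ^ p * M) + C * (1 + M) := by
    filter_upwards [hexp1.eventually_lt_const one_lt_two] with a ha z _
    refine (abs_sub _ _).trans (add_le_add ((hbound _ z).trans ?_) (hGb z))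
    rw [abs_of_pos (Real.exp_pos _)]
    gcongr
  have hfin := hT.add (hm.tendsto_integral_div hDmeas hDlim hDloc hDb)
  refine hfin.congr fun a => ?_
  have hi1 : Integrable G (m a) := integrable_of_bounded hGmeas hGb
  have hi2 : Integrable (fun z => ∫ y, f (Real.exp (a * κ) * y) ∂(K z)) (m a) :=
    integrable_of_bounded (hmeas _) (hbound _)
  rw [integral_sub hi1 (integrable_const _), integral_sub hi2 hi1, hG0]
  simp only [integral_const, probReal_univ, smul_eq_mul, one_mul]
  ring

/-- The substitution `u = t e^z` gives `u - t = t (e^z - 1) ~ t z`, whence the factor `t`. -/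
lemma HasGeneratorAt.tendsto_exp {P : ℝ≥0 → ℝ≥0 → ℝ → Measure ℝ} {t : ℝ≥0} (ht : 0 < t) {f : ℝ → ℝ}
    {x l : ℝ} (h : HasGeneratorAt P t f x l) :
    Tendsto (fun z => (∫ y, f y ∂(P t (t * expNeg (-z)) x) - f x) / z) (𝓝[>] 0) (𝓝 (l * t)) := by
  have ht0 : (0 : ℝ) < t := by exact_mod_cast ht
  have hu : Tendsto (fun z : ℝ => t * expNeg (-z)) (𝓝[>] 0) (𝓝[>] t) := by
    refine tendsto_nhdsWithin_iff.2 ⟨?_, ?_⟩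
    · have h1 : Continuous fun z : ℝ => t * expNeg (-z) := by fun_prop
      simpa [expNeg_zero] using (h1.tendsto 0).mono_left (nhdsWithin_le_nhds (s := Ioi 0))
    · filter_upwards [self_mem_nhdsWithin] with z hz
      have hz' : 0 < z := hz
      refine lt_mul_of_one_lt_right ht ?_
      rw [← expNeg_zero]; exact expNeg_strictAnti (by linarith)
  have h1 : Tendsto (fun z : ℝ => (t : ℝ) * ((Real.exp (z * 1) - 1) / z)) (𝓝[>] 0) (𝓝 (t * 1)) :=
    (IsConvexFlow.tendsto_exp_sub_one_div 1).const_mul _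
  rw [mul_one] at h1
  refine ((Tendsto.comp h hu).mul h1).congr' ?_
  filter_upwards [self_mem_nhdsWithin] with z hz
  have hz' : (0 : ℝ) < z := hz
  have h2 : Real.exp z - 1 ≠ 0 := by
    have := Real.add_one_lt_exp hz'.ne'
    linarith
  simp only [Function.comp_apply, NNReal.coe_mul, coe_expNeg, neg_neg, mul_one]
  have h3 : (t : ℝ) * Real.exp z - t = t * (Real.exp z - 1) := by ring
  rw [h3]
  field_simp

lemma tendsto_toNNReal_log_div {t : ℝ≥0} (ht : 0 < t) :
    Tendsto (fun u : ℝ≥0 => Real.toNNReal (Real.log (u / t : ℝ≥0))) (𝓝[>] t) (𝓝[>] 0) ∧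
    Tendsto (fun u : ℝ≥0 => (Real.toNNReal (Real.log (u / t : ℝ≥0)) : ℝ) / (u - t)) (𝓝[>] t)
      (𝓝 (1 / t)) := by
  have ht0 : (0 : ℝ) < t := by exact_mod_cast ht
  have hpos : ∀ u : ℝ≥0, t < u → 0 < Real.log (u / t : ℝ≥0) := fun u hu => by
    refine Real.log_pos ?_
    have : 1 < u / t := (one_lt_div ht).2 hu
    exact_mod_cast this
  have hlog : ContinuousAt (fun u : ℝ≥0 => Real.log (u / t : ℝ≥0)) t := by
    have : ((t / t : ℝ≥0) : ℝ) ≠ 0 := by rw [div_self ht.ne']; simp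
    refine ContinuousAt.log ?_ this
    exact (NNReal.continuous_coe.comp (continuous_id.div_const t)).continuousAt
  refine ⟨tendsto_nhdsWithin_iff.2 ⟨?_, ?_⟩, ?_⟩
  · have h1 := (continuous_real_toNNReal.continuousAt.comp hlog).tendsto
    simp only [Function.comp_apply, div_self ht.ne', NNReal.coe_one, Real.log_one,
      Real.toNNReal_zero] at h1
    exact h1.mono_left nhdsWithin_le_nhds
  · filter_upwards [self_mem_nhdsWithin] with u hu
    exact Real.toNNReal_pos.2 (hpos u hu)
  · have h1 := (Real.hasDerivAt_log ht0.ne').tendsto_slope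
    have h2 : Tendsto (fun u : ℝ≥0 => (u : ℝ)) (𝓝[>] t) (𝓝[≠] (t : ℝ)) := by
      refine tendsto_nhdsWithin_iff.2 ⟨?_, ?_⟩
      · exact (NNReal.continuous_coe.tendsto t).mono_left nhdsWithin_le_nhds
      · filter_upwards [self_mem_nhdsWithin] with u hu
        have : t < u := hu
        simpa using this.ne'
    rw [one_div]
    refine (h1.comp h2).congr' ?_
    filter_upwards [self_mem_nhdsWithin] with u hu
    have hu0 : (0 : ℝ) < u := by exact_mod_cast ht.trans hu
    rw [Real.coe_toNNReal _ (hpos u hu).le, Function.comp_apply, slope_def_field, NNReal.coe_div,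
      Real.log_div hu0.ne' ht0.ne']

lemma HasBoundedMoments.integral_le {P : ℝ≥0 → ℝ≥0 → ℝ → Measure ℝ} {κ p : ℝ} (hp : 0 ≤ p)
    (h : HasBoundedMoments P κ p) {t : ℝ≥0} (ht : 0 < t) (x : ℝ) :
    ∃ M : ℝ≥0, ∀ u : ℝ, 0 ≤ u →
      Integrable (fun y => |y| ^ p) (P (t * expNeg u) t (x * Real.exp (-(u * κ)))) ∧
      ∫ y, |y| ^ p ∂(P (t * expNeg u) t (x * Real.exp (-(u * κ)))) ≤ M := by
  obtain ⟨M, hM⟩ := h t ht x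
  have hc := continuous_abs_rpow hp
  have h0 : ∀ y : ℝ, 0 ≤ |y| ^ p := fun y => by positivity
  refine ⟨M, fun u hu => ⟨⟨hc.aestronglyMeasurable, ?_⟩, ?_⟩⟩
  · rw [hasFiniteIntegral_iff_ofReal (.of_forall h0)]
    exact (hM u hu).trans_lt ENNReal.coe_lt_top
  · rw [integral_eq_lintegral_of_nonneg_ae (.of_forall h0) hc.aestronglyMeasurable]
    exact ENNReal.toReal_le_coe_of_le_coe (hM u hu)

/-- The generator of the mimic at a positive time. -/
theorem hasGeneratorAt_mimicTransition {Ω : Type*} [MeasurableSpace Ω]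
    {μ : Measure Ω} [IsProbabilityMeasure μ] {P : ℝ≥0 → ℝ≥0 → ℝ → Measure ℝ} {κ : ℝ} (hκ : 0 < κ)
    (hP : IsTransitionFunction P) (hs : IsScaling P κ) (hm : IsMartingaleTransition P)
    (hr : IsRightContinuousTransition P) {β : ℝ} {ν : Measure ℝ} {ζ : ℝ≥0 → Ω → ℝ}
    (hζ : IsSubordinator ζ β ν μ) {p : ℝ} (hp : 0 ≤ p) (hM : HasBoundedMoments P κ p) {t : ℝ≥0}
    (ht : 0 < t) {f : ℝ → ℝ} (hf : IsC1OfGrowth p f) {x l : ℝ} (hl : HasGeneratorAt P t f x l) :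
    (∀ u, t ≤ u → Integrable f (mimicTransition P κ ζ μ t u x)) ∧
    (∀ u : ℝ, 0 < u → Integrable f (P (t * expNeg u) t (x * Real.exp (-(u * κ))))) ∧
    IntegrableOn (fun u : ℝ =>
      ∫ y, (f y - f x) ∂(P (t * expNeg u) t (x * Real.exp (-(u * κ))))) (Ioi 0) ν ∧
    HasGeneratorAt (mimicTransition P κ ζ μ) t f x
      (β * l + (1 - β) * (κ / (t : ℝ)) * x * deriv f x + 1 / (t : ℝ) * ∫ u in Ioi 0,
        (∫ y, (f y - f x) ∂(P (t * expNeg u) t (x * Real.exp (-(u * κ))))) ∂ν) := by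
  have ht0 : (0 : ℝ) < t := by exact_mod_cast ht
  have hQ := isConvexFlow_transition hP hs hm hr hM ht x
  obtain ⟨K, hKm, hK⟩ := exists_kernel_eq hs ht x hQ
  obtain ⟨C, hC0, hfp, hg, hC⟩ := hf.exists_dilation_bound hp
  obtain ⟨M, hMom⟩ := hM.integral_le hp ht x
  have hf1 := hf.1
  have hfc := hf1.continuous
  have hpc := continuous_abs_rpow hp
  have hlaw := hζ.isSubordinatorLaw
  have hζ0 : ∀ a ω, 0 ≤ ζ a ω := fun a ω => by
    simpa [hζ.zero ω] using hζ.monotone ω (zero_le (a := a))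
  have hKp : ∀ z, Integrable (fun y => |y| ^ p) (K z) ∧ ∫ y, |y| ^ p ∂(K z) ≤ M := fun z => by
    rw [hK]; exact hMom _ (le_max_right _ _)
  have hKpos : ∀ z, 0 < z → K z = P (t * expNeg z) t (x * Real.exp (-(z * κ))) := fun z hz => by
    rw [hK, max_eq_left hz.le]
  have hKQ : ∀ z, K z = (P t (t * expNeg (-(max z 0))) x).map
      fun y => Real.exp (-(max z 0 * κ)) * y := fun z => by
    rw [hK, hs.map_eq ht x (le_max_right z 0)]
  obtain ⟨hI, hT⟩ := tendsto_mixture hp hκ hQ hKQ hKp hf1 hC0 hfp hg hC (hl.tendsto_exp ht) hlaw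
  have hgrow : ∀ (π : Measure ℝ) [IsFiniteMeasure π] (ρ : ℝ), Integrable (fun y => |y| ^ p) π →
      Integrable (fun y => f (ρ * y)) π := fun π _ ρ hi => by
    refine (((integrable_const (1 : ℝ)).add (hi.const_mul (|ρ| ^ p))).const_mul C).mono'
      (by fun_prop) (.of_forall fun y => (hfp _).trans_eq ?_)
    rw [abs_mul, Real.mul_rpow (abs_nonneg _) (abs_nonneg _)]
    rfl
  have hmix : ∀ u, t ≤ u → Integrable (fun y => f (((u / t : ℝ≥0) : ℝ) ^ κ * y))
      (K ∘ₘ μ.map (ζ (Real.toNNReal (Real.log (u / t : ℝ≥0))))) := fun u _ => by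
    have := hlaw.isProbability (Real.toNNReal (Real.log (u / t : ℝ≥0)))
    refine hgrow _ _ ⟨hpc.aestronglyMeasurable, ?_⟩
    rw [hasFiniteIntegral_iff_ofReal (.of_forall fun y => by positivity),
      Measure.lintegral_bind K.aemeasurable (by fun_prop)]
    refine (lintegral_mono (g := fun _ => (M : ℝ≥0∞)) fun z => ?_).trans_lt
      (by rw [lintegral_const, measure_univ]; simp)
    rw [← ofReal_integral_eq_lintegral_ofReal (hKp z).1 (.of_forall fun y => by positivity),
      ← ENNReal.ofReal_coe_nnreal]
    exact ENNReal.ofReal_le_ofReal (hKp z).2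
  refine ⟨fun u hu => ?_, fun u hu => ?_, ?_, ?_⟩
  · rw [mimicTransition_eq hs hζ.measurable hζ0 ht hu x K hK,
      integrable_map_measure hfc.aestronglyMeasurable (by fun_prop)]
    exact hmix u hu
  · rw [← hKpos u hu]
    simpa using hgrow (K u) 1 (hKp u).1
  · exact hI.congr_fun (fun z hz => by simp only; rw [hKpos z hz]) measurableSet_Ioi
  · obtain ⟨h1, h2⟩ := tendsto_toNNReal_log_div ht
    have h3 := (hT.comp h1).mul h2
    rw [setIntegral_congr_fun (g := fun u => ∫ y, (f y - f x)
      ∂(P (t * expNeg u) t (x * Real.exp (-(u * κ))))) measurableSet_Ioi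
      fun z hz => by simp only; rw [hKpos z hz]] at h3
    -- The two dilations act in opposite directions: `-β κ x f'(x)` comes from the slope of `G` at
    -- `0` and `+κ x f'(x)` from the outer factor, which together give the coefficient `1 - β`.
    have hval : ∀ J : ℝ, (β * (l * t - κ * x * deriv f x) + J + κ * x * deriv f x) * (1 / t)
        = β * l + (1 - β) * (κ / (t : ℝ)) * x * deriv f x + 1 / (t : ℝ) * J := fun J => by
      field_simp
      ring
    rw [hval] at h3
    refine h3.congr' ?_
    filter_upwards [self_mem_nhdsWithin] with u hu
    have htu : t < u := hu
    have hu0 : (0 : ℝ) < (u / t : ℝ≥0) := by exact_mod_cast div_pos (ht.trans htu) ht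
    have hlog : 0 < Real.log (u / t : ℝ≥0) := by
      refine Real.log_pos ?_
      have : 1 < u / t := (one_lt_div ht).2 htu
      exact_mod_cast this
    have := hlaw.isProbability (Real.toNNReal (Real.log (u / t : ℝ≥0)))
    rw [mimicTransition_eq hs hζ.measurable hζ0 ht htu.le x K hK,
      integral_map (by fun_prop) hfc.aestronglyMeasurable, integral_comp_measure (hmix u htu.le)]
    simp only [Function.comp_apply]
    rw [Real.coe_toNNReal _ hlog.le, Real.rpow_def_of_pos hu0]
    have := hlog.ne'
    -- The quotient by `a = log (u/t)` times `a / (u - t)` is the quotient by `u - t`; `a ≠ 0`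
    -- because `u > t`.
    rw [div_mul_div_comm, mul_comm (Real.log _) ((u : ℝ) - t), mul_div_mul_right _ _ this]

end Mimic

theorem mainTheorem3
    {Ω₁ Ω₂ Ω₃ : Type*} [MeasurableSpace Ω₁] [MeasurableSpace Ω₂] [MeasurableSpace Ω₃]
    (μ₁ : Measure Ω₁) [IsProbabilityMeasure μ₁]
    (μ₂ : Measure Ω₂) [IsProbabilityMeasure μ₂]
    (μ₃ : Measure Ω₃) [IsProbabilityMeasure μ₃]
    (κ : ℝ) (hκ : 0 < κ)
    (Z : ℝ≥0 → Ω₁ → ℝ) (P : ℝ≥0 → ℝ≥0 → ℝ → Measure ℝ)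
    (hZ : Mimic.IsSelfSimilarMarkovMartingale Z P κ μ₁)
    (β : ℝ) (ν : Measure ℝ) (ζ : ℝ≥0 → Ω₂ → ℝ)
    (hζ : Mimic.IsSubordinator ζ β ν μ₂)
    (hψ : Mimic.laplaceExponent β ν κ = κ)
    (X : ℝ≥0 → Ω₃ → ℝ) (hX : Mimic.IsMimic X μ₃ P κ ζ μ₂)
    (DL : ℝ≥0 → Set (ℝ → ℝ)) (L : ℝ≥0 → (ℝ → ℝ) → ℝ → ℝ)
    (hL : Mimic.IsGenerator P DL L)
    (DA : ℝ≥0 → Set (ℝ → ℝ)) (A : ℝ≥0 → (ℝ → ℝ) → ℝ → ℝ)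
    (hA : Mimic.IsGenerator (Mimic.mimicTransition P κ ζ μ₂) DA A) :
    (∀ f ∈ DL 0, f ∈ DA 0 ∧ ∀ x ∈ Mimic.states 0, A 0 f x = L 0 f x) ∧
    ∀ p : ℝ, 0 ≤ p → Mimic.HasBoundedMoments P κ p →
      ∀ t : ℝ≥0, 0 < t → ∀ f ∈ DL t, Mimic.IsC1OfGrowth p f →
        f ∈ DA t ∧ ∀ x : ℝ,
          (∀ u : ℝ, 0 < u →
            Integrable f (P (t * Mimic.expNeg u) t (x * Real.exp (-(u * κ))))) ∧
          IntegrableOn (fun u : ℝ =>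
            ∫ y, (f y - f x) ∂(P (t * Mimic.expNeg u) t (x * Real.exp (-(u * κ)))))
            (Ioi 0) ν ∧
          A t f x = β * L t f x + (1 - β) * (κ / (t : ℝ)) * x * deriv f x
            + 1 / (t : ℝ) * ∫ u in Ioi 0,
              (∫ y, (f y - f x) ∂(P (t * Mimic.expNeg u) t (x * Real.exp (-(u * κ))))) ∂ν := by
  refine ⟨fun f hf => ?_, fun p hp hM t ht f hf hfC1 => ?_⟩
  -- From time `0` the two transition functions coincide, hence so do the domains and the limits.
  · have h0 : ∀ u x, Mimic.mimicTransition P κ ζ μ₂ 0 u x = P 0 u x := fun u x => by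
      simp [Mimic.mimicTransition]
    have hgen : ∀ x a, Mimic.HasGeneratorAt (Mimic.mimicTransition P κ ζ μ₂) 0 f x a ↔
        Mimic.HasGeneratorAt P 0 f x a := fun x a => by
      simp [Mimic.HasGeneratorAt, h0]
    have hmem : f ∈ DA 0 := by
      rw [hA.mem_iff]
      simp_rw [h0, hgen]
      exact (hL.mem_iff 0 f).1 hf
    refine ⟨hmem, fun x hx => ?_⟩
    exact tendsto_nhds_unique ((hgen x _).1 (hA.hasGeneratorAt 0 f hmem x hx))
      (hL.hasGeneratorAt 0 f hf x hx)
  · have key := fun x => Mimic.hasGeneratorAt_mimicTransition hκ hZ.transition hZ.scaling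
      hZ.martingaleTransition hZ.rightContinuous hζ hp hM ht hfC1
      (hL.hasGeneratorAt t f hf x (Mimic.mem_states_of_pos ht x))
    have hmem : f ∈ DA t := (hA.mem_iff t f).2
      ⟨hfC1.1.continuous.measurable, fun x _ => ⟨(key x).1, _, (key x).2.2.2⟩⟩
    refine ⟨hmem, fun x => ⟨(key x).2.1, (key x).2.2.1, ?_⟩⟩
    -- `A` is known only as a limit of difference quotients, so its value is identified by
    -- uniqueness of limits.
    exact tendsto_nhds_unique (hA.hasGeneratorAt t f hmem x (Mimic.mem_states_of_pos ht x))
      (key x).2.2.2
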